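/- A $\{1,3\}$-tree is a finite tree $T$ in which every node has degree $1$ or $3$; let $E$ be its set of edges and $I$ its set of internal nodes, that is, nodes of degree $3$. Let $\mathcal{P}_T\subseteq\mathbb{R}^E$ be the set of all $w$ such that, for every $v\in I$ with incident edges $a,b,c$, $$w_a\le w_b+w_c,\quad w_b\le w_a+w_c,\quad w_c\le w_a+w_b,\quad w_a+w_b+w_c\le 1,$$ and such that $0\le w_e\le \tfrac12$ if $T$ consists of a single edge $e$. Let $\mathcal{Q}_T\subseteq\mathbb{R}^E\times\mathbb{R}^I$ be the set of all $(w,z)$ such that, for every $v\in I$ with incident edges $a,b,c$, $$w_a\le w_b+w_c,\quad w_b\le w_a+w_c,\quad w_c\le w_a+w_b,\quad w_a+w_b+w_c=2z_v,\quad z_v\le 1,$$ and such that $0\le w_e\le 1$ if $T$ consists of a single edge $e$. For an integer $t\ge 0$ let $$L^{\mathcal{P}}_T(t)=|t\mathcal{P}_T\cap\mathbb{Z}^E|,\qquad L^{\mathcal{Q}}_T(t)=|t\mathcal{Q}_T\cap(\mathbb{Z}^E\times\mathbb{Z}^I)|,$$ where $tX=\{tx: x\in X\}$. A function $f$ on the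 nonnegative integers is a quasi-polynomial if there are an integer $\alpha\ge1$ and polynomials $p_0,\dots,p_{\alpha-1}$ with $f(t)=p_i(t)$ whenever $t\equiv i \pmod{\alpha}$; the least such $\alpha$ is the period of $f$. Theorem. If $T$ is a $\{1,3\}$-tree, then $L^{\mathcal{P}}_T(t)$ is a quasi-polynomial of period exactly $2$, and $L^{\mathcal{Q}}_T(t)$ is a quasi-polynomial of period $1$, i.e. a polynomial in $t$. -/

import Mathlib

open scoped Pointwise

/-! ### Quasi-polynomials and Ehrhart functions -/

/-- `f` is given by a list of `α ≥ 1` polynomials `p 0, …, p (α - 1)`: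
`f t = p i (t)` whenever `t ≡ i (mod α)`. -/
def IsQuasiPolynomialMod (f : ℕ → ℕ) (α : ℕ) : Prop :=
  0 < α ∧ ∃ p : Fin α → Polynomial ℝ,
    ∀ (i : Fin α) (t : ℕ), t ≡ (i : ℕ) [MOD α] → (f t : ℝ) = (p i).eval (t : ℝ)

/-- `f` is a quasi-polynomial whose period, the least possible number of constituents, is `α`. -/
def IsQuasiPolynomialOfPeriod (f : ℕ → ℕ) (α : ℕ) : Prop :=
  IsLeast {β : ℕ | IsQuasiPolynomialMod f β} α

/-- The points of `ℝ^ι` with integer coordinates. -/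
def integerPoints (ι : Type*) : Set (ι → ℝ) :=
  {x | ∀ i, ∃ n : ℤ, x i = (n : ℝ)}

/-- The number of points of `Λ` in the dilate `tP = {t x : x ∈ P}`. -/
noncomputable def ehrhartFunction {M : Type*} [SMul ℝ M] (Λ P : Set M) (t : ℕ) : ℕ :=
  (((t : ℝ) • P) ∩ Λ).ncard

namespace SimpleGraph

variable {V : Type*} [Fintype V] (G : SimpleGraph V) [DecidableRel G.Adj]

/-- Every node has degree `1` or `3`. -/
def IsOneThreeGraph : Prop :=
  ∀ v, G.degree v = 1 ∨ G.degree v = 3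

/-- The internal nodes: those of degree `3`. -/
abbrev InternalNode : Type _ := {v : V // G.degree v = 3}

/-- `a`, `b`, `c` are three different edges incident to `v`; when `v` has degree `3` these are
the three edges at `v`, in any order. -/
def EdgesAt (v : V) (a b c : G.edgeSet) : Prop :=
  a ≠ b ∧ a ≠ c ∧ b ≠ c ∧ v ∈ (a : Sym2 V) ∧ v ∈ (b : Sym2 V) ∧ v ∈ (c : Sym2 V)

/-- The edge `e` alone is a component of the graph: no other edge meets it. -/
def IsComponentEdge (e : G.edgeSet) : Prop :=
  ∀ v ∈ (e : Sym2 V), ∀ f : G.edgeSet, v ∈ (f : Sym2 V) → f = e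

/-- The polytope `P_G` in `ℝ^E`. Since `a`, `b`, `c` range over all orderings of the edges at `v`,
the first line covers the three triangle inequalities at `v`. -/
def polytopeP : Set (G.edgeSet → ℝ) :=
  {w | (∀ (v : G.InternalNode) (a b c : G.edgeSet), G.EdgesAt v a b c →
          w a ≤ w b + w c ∧
          w a + w b + w c ≤ 1) ∧
       ∀ e, G.IsComponentEdge e → 0 ≤ w e ∧ w e ≤ 1 / 2}

/-- The polytope `Q_G` in `ℝ^E × ℝ^I`, where `I` is the set of internal nodes. -/
def polytopeQ : Set ((G.edgeSet → ℝ) × (G.InternalNode → ℝ)) :=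
  {wz | (∀ (v : G.InternalNode) (a b c : G.edgeSet), G.EdgesAt v a b c →
          wz.1 a ≤ wz.1 b + wz.1 c ∧
          wz.1 a + wz.1 b + wz.1 c = 2 * wz.2 v ∧
          wz.2 v ≤ 1) ∧
        ∀ e, G.IsComponentEdge e → 0 ≤ wz.1 e ∧ wz.1 e ≤ 1}

/-- `L^P_G(t)`, the number of integer points of `t P_G`. -/
noncomputable def ehrhartP (t : ℕ) : ℕ :=
  ehrhartFunction (integerPoints G.edgeSet) G.polytopeP t

/-- `L^Q_G(t)`, the number of integer points of `t Q_G`. -/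
noncomputable def ehrhartQ (t : ℕ) : ℕ :=
  ehrhartFunction (integerPoints G.edgeSet ×ˢ integerPoints G.InternalNode) G.polytopeQ t

end SimpleGraph

/-! Integer points of the dilates are labelings of the edges by natural numbers that satisfy, at
every internal node, `TriangleRule t` (for P) or `EvenTriangleRule t` (for Q, where z is half the
perimeter, whence the parity condition). Both relations are fusion rules: they are symmetric, 0 is
neutral, and the number of e completing (a, b, e) and (e, c, d) does not change when b and c are
exchanged. Hence convolution of functions of labels is associative. Root the tree at a leaf: every
branch contributes a convolution power of the constant function 1, whatever its shape, and the whole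
count is `fusionPow M N (k + 1) 0` with k depending on the tree alone.

It remains to iterate convolution with 1. In suitable coordinates this operator sums g (i + j) over
rectangles, and a second difference summed over a rectangle telescopes to its four corners. So, on
functions symmetric about the centre of the label range, the operator inverts a multiple of the
discrete second derivative with boundary conditions. Central factorials C_j are even with δ² C_{j+1}
= C_j, so the iterates have a generating series F(κu, y) / D(u), where F(u, y) = ∑ C_j(y) u^j and D
encodes the boundary condition: for Q, κ = -2, y = t/2 - s and D = F(κu, t/2 + 1); for P with t odd,
κ = -1, y = t/2 - 2s and D = F(κu, t/2 + 1); for P with t even, κ = -4, y = t/4 - s and D is the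
mean of F(κu, t/4 + 1) and F(κu, t/4). The coefficients of D are polynomials in t with leading term
1, so those of its inverse are polynomials too, and s = 0 gives the counts.

The two constituents for P differ at t = -1. There the odd one equals its own boundary value at y =
1/2, which is 0, while the even one is positive by a comparison of central factorials at 1/4 and
3/4. -/

/-! ### Fusion rules -/

/-- A symmetric ternary relation on the labels `0, …, M` for which `0` is neutral and which
is associative in the sense of counting. -/
structure FusionRule (M : ℕ) (N : ℕ → ℕ → ℕ → Prop) : Prop where
  swap_left : ∀ {a b c}, N a b c → N b a c
  swap_right : ∀ {a b c}, N a b c → N a c b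
  le : ∀ {a b c}, N a b c → a ≤ M
  zero_iff : ∀ b c, N 0 b c ↔ b = c ∧ b ≤ M
  assoc : ∀ a b c d, {e | N a b e ∧ N e c d}.ncard = {e | N a c e ∧ N e b d}.ncard

open Classical in
/-- The product of two functions of labels determined by a relation. -/
noncomputable def fusionConv (M : ℕ) (N : ℕ → ℕ → ℕ → Prop) (f g : ℕ → ℕ) (s : ℕ) : ℕ :=
  ∑ b ∈ Finset.range (M + 1), ∑ c ∈ Finset.range (M + 1), if N s b c then f b * g c else 0

/-- The powers of the constant function `1` with respect to `fusionConv`, starting with the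
first one. -/
noncomputable def fusionPow (M : ℕ) (N : ℕ → ℕ → ℕ → Prop) : ℕ → ℕ → ℕ
  | 0 => fun _ => 1
  | k + 1 => fusionConv M N (fun _ => 1) (fusionPow M N k)

namespace FusionRule

variable {M : ℕ} {N : ℕ → ℕ → ℕ → Prop}

theorem swap_right_iff (h : FusionRule M N) {a b c : ℕ} : N a b c ↔ N a c b :=
  ⟨h.swap_right, h.swap_right⟩

open Classical in
theorem sum_assoc (h : FusionRule M N) (a b c d : ℕ) :
    ∑ e ∈ Finset.range (M + 1), (if N a b e ∧ N e c d then 1 else 0) =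
      ∑ e ∈ Finset.range (M + 1), (if N a c e ∧ N e b d then 1 else 0) := by
  have key : ∀ b c, ∑ e ∈ Finset.range (M + 1), (if N a b e ∧ N e c d then 1 else 0) =
      {e | N a b e ∧ N e c d}.ncard := by
    intro b c
    rw [← Finset.card_filter, ← Set.ncard_coe_finset]
    congr 1
    ext e
    simp only [Finset.coe_filter, Finset.mem_range, Set.mem_ofPred_eq, and_iff_right_iff_imp]
    exact fun he => Nat.lt_succ_of_le (h.le he.2)
  rw [key, key, h.assoc]

/-- Both sides expand to sums of f d * g e * k c weighted by the number of intermediate labels x.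
The two weights differ by exchanging c and d, which is what `sum_assoc` allows. -/
theorem conv_assoc (h : FusionRule M N) (f g k : ℕ → ℕ) :
    fusionConv M N (fusionConv M N f g) k = fusionConv M N f (fusionConv M N g k) := by
  classical
  funext s
  have hl : fusionConv M N (fusionConv M N f g) k s =
      ∑ c ∈ Finset.range (M + 1), ∑ d ∈ Finset.range (M + 1), ∑ e ∈ Finset.range (M + 1),
        f d * g e * k c *
          ∑ x ∈ Finset.range (M + 1), (if N s c x ∧ N x d e then 1 else 0) := by
    unfold fusionConv
    rw [Finset.sum_comm]
    refine Finset.sum_congr rfl fun c _ => ?_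
    simp only [Finset.mul_sum]
    rw [Finset.sum_congr rfl (fun d _ => Finset.sum_comm), Finset.sum_comm]
    refine Finset.sum_congr rfl fun x _ => ?_
    rw [h.swap_right_iff]
    by_cases hx : N s c x
    · simp only [hx, if_true, true_and, Finset.sum_mul]
      refine Finset.sum_congr rfl fun d _ => Finset.sum_congr rfl fun e _ => ?_
      split_ifs <;> simp
    · simp [hx]
  have hr : fusionConv M N f (fusionConv M N g k) s =
      ∑ c ∈ Finset.range (M + 1), ∑ d ∈ Finset.range (M + 1), ∑ e ∈ Finset.range (M + 1),
        f d * g e * k c *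
          ∑ x ∈ Finset.range (M + 1), (if N s d x ∧ N x c e then 1 else 0) := by
    unfold fusionConv
    rw [Finset.sum_comm (s := Finset.range (M + 1)) (t := Finset.range (M + 1))
      (f := fun c d => ∑ e ∈ Finset.range (M + 1), f d * g e * k c *
          ∑ x ∈ Finset.range (M + 1), (if N s d x ∧ N x c e then 1 else 0))]
    refine Finset.sum_congr rfl fun d _ => ?_
    simp only [Finset.mul_sum]
    rw [Finset.sum_congr rfl (fun d _ => Finset.sum_comm), Finset.sum_comm]
    refine Finset.sum_congr rfl fun x _ => ?_
    by_cases hx : N s d x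
    · simp only [hx, if_true, true_and]
      rw [Finset.sum_comm]
      refine Finset.sum_congr rfl fun c _ => Finset.sum_congr rfl fun e _ => ?_
      rw [h.swap_right_iff]
      split_ifs <;> simp [mul_assoc]
    · simp [hx]
  rw [hl, hr]
  refine Finset.sum_congr rfl fun c _ => Finset.sum_congr rfl fun d _ =>
    Finset.sum_congr rfl fun e _ => ?_
  rw [h.sum_assoc]

theorem conv_pow_pow (h : FusionRule M N) (i j : ℕ) :
    fusionConv M N (fusionPow M N i) (fusionPow M N j) = fusionPow M N (i + j + 1) := by
  induction i with
  | zero => rw [Nat.zero_add]; rfl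
  | succ i ih =>
    have : i + 1 + j + 1 = (i + j + 1) + 1 := by ring
    rw [this]
    change fusionConv M N (fusionConv M N _ (fusionPow M N i)) _ = fusionConv M N _ _
    rw [h.conv_assoc, ih]

/-- Neutrality of 0 forces b = c in the convolution evaluated at 0, leaving the plain sum over
labels. -/
theorem sum_pow (h : FusionRule M N) (k : ℕ) :
    ∑ s ∈ Finset.range (M + 1), fusionPow M N k s = fusionPow M N (k + 1) 0 := by
  classical
  rw [fusionPow, fusionConv]
  refine Finset.sum_congr rfl fun b hb => ?_
  have hb' : b ≤ M := Nat.lt_succ_iff.mp (Finset.mem_range.mp hb)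
  rw [Finset.sum_eq_single_of_mem b hb]
  · rw [if_pos ((h.zero_iff b b).mpr ⟨rfl, hb'⟩), one_mul]
  · intro c _ hcb
    rw [if_neg]
    rw [h.zero_iff]
    exact fun hh => hcb hh.1.symm

end FusionRule

/-- The triangle inequalities, with perimeter at most `t`. -/
def TriangleRule (t a b c : ℕ) : Prop :=
  a ≤ b + c ∧ b ≤ a + c ∧ c ≤ a + b ∧ a + b + c ≤ t

/-- The triangle inequalities, with even perimeter at most `2 * t`. -/
def EvenTriangleRule (t a b c : ℕ) : Prop :=
  a ≤ b + c ∧ b ≤ a + c ∧ c ≤ a + b ∧ a + b + c ≤ 2 * t ∧ Even (a + b + c)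

theorem ncard_le_ncard_of_shift {A B : Set ℕ} (hB : B.Finite) (p q : ℕ)
    (hAB : ∀ e ∈ A, p ≤ e ∧ e - p + q ∈ B) : A.ncard ≤ B.ncard := by
  refine Set.ncard_le_ncard_of_injOn (fun e => e - p + q) (fun e he => (hAB e he).2) ?_ hB
  intro e he e' he' hee
  have h1 := (hAB e he).1
  have h2 := (hAB e' he').1
  simp only at hee
  omega

/-- The admissible e form the interval from max(|a-b|, |c-d|) to min(a+b, c+d, t-a-b, t-c-d).
Exchanging b and c keeps its length, so translation by the difference of left endpoints carries one
interval to the other. The maxima of truncated differences are absolute values. -/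
theorem TriangleRule.shift {t a b c d e : ℕ} (h : TriangleRule t a b e)
    (h' : TriangleRule t e c d) :
    max (max (a - b) (b - a)) (max (c - d) (d - c)) ≤ e ∧
      TriangleRule t a c (e - max (max (a - b) (b - a)) (max (c - d) (d - c)) +
        max (max (a - c) (c - a)) (max (b - d) (d - b))) ∧
      TriangleRule t (e - max (max (a - b) (b - a)) (max (c - d) (d - c)) +
        max (max (a - c) (c - a)) (max (b - d) (d - b))) b d := by
  unfold TriangleRule at *
  omega

theorem TriangleRule.finite_assoc (t a b c d : ℕ) :
    {e | TriangleRule t a b e ∧ TriangleRule t e c d}.Finite := by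
  refine (Set.finite_le_nat t).subset ?_
  rintro e ⟨⟨_, _, _, h⟩, _⟩
  exact (show e ≤ t by omega)

theorem TriangleRule.ncard_assoc_le (t a b c d : ℕ) :
    {e | TriangleRule t a b e ∧ TriangleRule t e c d}.ncard ≤
      {e | TriangleRule t a c e ∧ TriangleRule t e b d}.ncard :=
  ncard_le_ncard_of_shift (TriangleRule.finite_assoc t a c b d) _ _ fun _ he => he.1.shift he.2

theorem evenTriangleRule_iff {t a b c : ℕ} :
    EvenTriangleRule t a b c ↔ TriangleRule (2 * t) a b c ∧ Even (a + b + c) := by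
  simp only [EvenTriangleRule, TriangleRule, and_assoc]

theorem max_sub_mod_two {a b c d n : ℕ} (h : (a + b) % 2 = n % 2) (h' : (c + d) % 2 = n % 2) :
    max (max (a - b) (b - a)) (max (c - d) (d - c)) % 2 = n % 2 := by
  have h1 : max (a - b) (b - a) % 2 = n % 2 := by omega
  have h2 : max (c - d) (d - c) % 2 = n % 2 := by omega
  rcases max_choice (max (a - b) (b - a)) (max (c - d) (d - c)) with h3 | h3 <;> rw [h3]
  exacts [h1, h2]

/-- The translation used for `TriangleRule (2 * t)` still works: each left endpoint has the parity
required of e in its interval, by `max_sub_mod_two`, so e minus the endpoint is even. -/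
theorem EvenTriangleRule.ncard_assoc_le (t a b c d : ℕ) :
    {e | EvenTriangleRule t a b e ∧ EvenTriangleRule t e c d}.ncard ≤
      {e | EvenTriangleRule t a c e ∧ EvenTriangleRule t e b d}.ncard := by
  simp only [evenTriangleRule_iff]
  refine ncard_le_ncard_of_shift ((TriangleRule.finite_assoc (2 * t) a c b d).subset
    fun e he => ⟨he.1.1, he.2.1⟩) (max (max (a - b) (b - a)) (max (c - d) (d - c)))
    (max (max (a - c) (c - a)) (max (b - d) (d - b))) ?_
  rintro e ⟨⟨h1, h2⟩, ⟨h3, h4⟩⟩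
  obtain ⟨h5, h6, h7⟩ := h1.shift h3
  rw [Nat.even_iff] at h2 h4
  have hp := max_sub_mod_two (a := a) (b := b) (c := c) (d := d) (n := a + b) rfl (by omega)
  have hq := max_sub_mod_two (a := a) (b := c) (c := b) (d := d) (n := a + c) rfl (by omega)
  refine ⟨h5, ⟨h6, ?_⟩, h7, ?_⟩ <;>
  · clear h1 h3 h6 h7
    generalize max (max (a - b) (b - a)) (max (c - d) (d - c)) = p at *
    generalize max (max (a - c) (c - a)) (max (b - d) (d - b)) = q at *
    rw [Nat.even_iff]
    omega

theorem triangleRule_fusionRule (t : ℕ) : FusionRule (t / 2) (TriangleRule t) where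
  swap_left := by unfold TriangleRule; intros; omega
  swap_right := by unfold TriangleRule; intros; omega
  le := by unfold TriangleRule; intros; omega
  zero_iff := by unfold TriangleRule; intros; omega
  assoc a b c d :=
    (TriangleRule.ncard_assoc_le t a b c d).antisymm (TriangleRule.ncard_assoc_le t a c b d)

theorem evenTriangleRule_fusionRule (t : ℕ) : FusionRule t (EvenTriangleRule t) where
  swap_left := by unfold EvenTriangleRule; simp only [Nat.even_iff]; intros; omega
  swap_right := by unfold EvenTriangleRule; simp only [Nat.even_iff]; intros; omega
  le := by unfold EvenTriangleRule; intros; omega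
  zero_iff := by unfold EvenTriangleRule; simp only [Nat.even_iff]; intros; omega
  assoc a b c d :=
    (EvenTriangleRule.ncard_assoc_le t a b c d).antisymm (EvenTriangleRule.ncard_assoc_le t a c b d)

/-! ### Central factorial polynomials -/

open Polynomial in
/-- The polynomial `X² (X² - 1²) ⋯ (X² - (j - 1)²) / (2 j)!`. -/
noncomputable def centralFactorial : ℕ → ℝ[X]
  | 0 => 1
  | j + 1 => C (1 / ((2 * j + 2) * (2 * j + 1) : ℝ)) * centralFactorial j * (X ^ 2 - C ((j : ℝ) ^ 2))

theorem centralFactorial_zero_eval (y : ℝ) : (centralFactorial 0).eval y = 1 := by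
  simp [centralFactorial]

theorem centralFactorial_succ_eval (j : ℕ) (y : ℝ) :
    (centralFactorial (j + 1)).eval y =
      (centralFactorial j).eval y * (y ^ 2 - (j : ℝ) ^ 2) / ((2 * j + 2) * (2 * j + 1)) := by
  simp only [centralFactorial, Polynomial.eval_mul, Polynomial.eval_C, Polynomial.eval_sub,
    Polynomial.eval_pow, Polynomial.eval_X]
  ring

theorem centralFactorial_eval_neg (j : ℕ) (y : ℝ) :
    (centralFactorial j).eval (-y) = (centralFactorial j).eval y := by
  induction j with
  | zero => simp [centralFactorial]
  | succ j ih => rw [centralFactorial_succ_eval, centralFactorial_succ_eval, ih, neg_sq]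

/-- Only the second difference is used later. The first-difference identity makes the induction
close: multiplying by y² - (j+1)² produces cross terms ±2y at y ± 1, which pair with the first
difference. -/
theorem centralFactorial_differences (j : ℕ) (y : ℝ) :
    (centralFactorial (j + 1)).eval (y + 1) - 2 * (centralFactorial (j + 1)).eval y +
        (centralFactorial (j + 1)).eval (y - 1) = (centralFactorial j).eval y ∧
      y * ((centralFactorial (j + 1)).eval (y + 1) - (centralFactorial (j + 1)).eval (y - 1)) =
        4 * (j + 1) * (centralFactorial (j + 1)).eval y + j * (centralFactorial j).eval y := by
  induction j with
  | zero =>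
    simp only [centralFactorial_succ_eval, centralFactorial_zero_eval]
    constructor <;> · push_cast; ring
  | succ j ih =>
    obtain ⟨h1, h2⟩ := ih
    have h3 := centralFactorial_succ_eval j y
    rw [centralFactorial_succ_eval (j + 1), centralFactorial_succ_eval (j + 1),
      centralFactorial_succ_eval (j + 1)]
    generalize (centralFactorial (j + 1)).eval (y + 1) = p at *
    generalize (centralFactorial (j + 1)).eval (y - 1) = q at *
    generalize (centralFactorial (j + 1)).eval y = f at *
    generalize (centralFactorial j).eval y = c at *
    have hp : p = 2 * f - q + c := by linarith
    subst hp
    push_cast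
    rw [eq_div_iff (by positivity)] at h3
    constructor
    · field_simp
      linear_combination 2 * h2 - h3
    · field_simp
      linear_combination (y ^ 2 - (j + 1) ^ 2 + 1) * h2 - ((j : ℝ) + 2) * h3

/-! ### Rectangle sums -/

theorem sum_range_sum_range_second_difference (V : ℕ → ℝ) (p q : ℕ) :
    ∑ i ∈ Finset.range p, ∑ j ∈ Finset.range q, (V (i + j + 2) - 2 * V (i + j + 1) + V (i + j)) =
      V (p + q) - V p - V q + V 0 := by
  have inner : ∀ i, ∑ j ∈ Finset.range q, (V (i + j + 2) - 2 * V (i + j + 1) + V (i + j)) =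
      (V (i + 1 + q) - V (i + 1)) - (V (i + q) - V i) := by
    intro i
    have := Finset.sum_range_sub (fun j => V (i + j + 1) - V (i + j)) q
    rw [show V (i + 1 + q) - V (i + 1) - (V (i + q) - V i) =
      V (i + q + 1) - V (i + q) - (V (i + 0 + 1) - V (i + 0)) by
        rw [add_right_comm i 1 q, add_zero]; ring, ← this]
    refine Finset.sum_congr rfl fun j _ => ?_
    rw [← add_assoc i j 1]
    ring
  simp only [inner]
  rw [Finset.sum_range_sub (fun i => V (i + q) - V i) p, zero_add]
  ring

theorem sum_range_two_mul (f : ℕ → ℝ) (p : ℕ) :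
    ∑ i ∈ Finset.range (2 * p), f i =
      ∑ i ∈ Finset.range p, f (2 * i) + ∑ i ∈ Finset.range p, f (2 * i + 1) := by
  induction p with
  | zero => simp
  | succ p ih =>
    rw [show 2 * (p + 1) = 2 * p + 1 + 1 by ring, Finset.sum_range_succ, Finset.sum_range_succ,
      ih, Finset.sum_range_succ, Finset.sum_range_succ]
    ring

/-- Reverse both indices and apply n ↦ t - n. The 4 in `ht` comes from i ↦ p - 1 - i and j ↦ q - 1 -
j, both doubled. -/
theorem sum_rectangle_reflect (f : ℕ → ℝ) {t p q c d : ℕ}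
    (hf : ∀ n ≤ t, f (t - n) = f n) (ht : t + 4 = 2 * p + 2 * q + c + d) :
    ∑ i ∈ Finset.range p, ∑ j ∈ Finset.range q, f (2 * i + 2 * j + c) =
      ∑ i ∈ Finset.range p, ∑ j ∈ Finset.range q, f (2 * i + 2 * j + d) := by
  rw [← Finset.sum_range_reflect]
  refine Finset.sum_congr rfl fun i hi => ?_
  rw [← Finset.sum_range_reflect]
  refine Finset.sum_congr rfl fun j hj => ?_
  rw [Finset.mem_range] at hi hj
  rw [← hf (2 * i + 2 * j + d) (by omega)]
  congr 1
  omega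

/-- For an odd `t`, a function on `0, …, t` that is invariant under `n ↦ t - n` has equal sums over
the even and the odd points of a rectangle centred at `t / 2`. -/
theorem two_mul_sum_even_eq_sum_rectangle (f : ℕ → ℝ) {t p q : ℕ}
    (hf : ∀ n ≤ t, f (t - n) = f n) (ht : t + 1 = 2 * p + 2 * q) :
    2 * (∑ i ∈ Finset.range p, ∑ j ∈ Finset.range (q + 1), f (2 * i + 2 * j) +
      ∑ i ∈ Finset.range p, ∑ j ∈ Finset.range q, f (2 * i + 2 * j + 2)) =
    ∑ i ∈ Finset.range (2 * p), ∑ j ∈ Finset.range (2 * q + 1), f (i + j) := by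
  have inner : ∀ i, ∑ j ∈ Finset.range (2 * q + 1), f (i + j) =
      ∑ j ∈ Finset.range (q + 1), f (i + 2 * j) + ∑ j ∈ Finset.range q, f (i + 2 * j + 1) := by
    intro i
    rw [Finset.sum_range_succ, sum_range_two_mul, Finset.sum_range_succ]
    simp only [add_assoc]
    ring
  simp only [inner]
  rw [sum_range_two_mul]
  simp only [Finset.sum_add_distrib]
  have h1 := sum_rectangle_reflect f (p := p) (q := q + 1) (c := 0) (d := 1) hf (by omega)
  have h2 := sum_rectangle_reflect f (p := p) (q := q) (c := 2) (d := 1) hf (by omega)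
  have e1 : ∀ i j, 2 * i + 1 + 2 * j = 2 * i + 2 * j + 1 := by intros; ring
  simp only [e1]
  simp only [add_zero] at h1
  linarith

/-! ### Convolution with the constant 1 as a sum over rectangles -/

open Classical in
theorem fusionConv_one (M : ℕ) (N : ℕ → ℕ → ℕ → Prop) (g : ℕ → ℕ) (s : ℕ) :
    fusionConv M N (fun _ => 1) g s =
      ∑ x ∈ (Finset.range (M + 1) ×ˢ Finset.range (M + 1)).filter (fun x => N s x.1 x.2),
        g x.2 := by
  rw [Finset.sum_filter, Finset.sum_product]
  simp [fusionConv]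

/-- Put b = s + i - j and c = i + j. The three triangle inequalities become i ≥ 0, j ≥ 0 and j ≤ s,
and the perimeter is 2s + 2i, so its bound reads i ≤ t - s. -/
theorem fusionConv_one_evenTriangleRule (t s : ℕ) (hs : s ≤ t) (g : ℕ → ℕ) :
    fusionConv t (EvenTriangleRule t) (fun _ => 1) g s =
      ∑ i ∈ Finset.range (t - s + 1), ∑ j ∈ Finset.range (s + 1), g (i + j) := by
  classical
  rw [fusionConv_one, ← Finset.sum_product']
  symm
  refine Finset.sum_nbij' (fun x => (s + x.1 - x.2, x.1 + x.2))
    (fun x => ((x.1 + x.2 - s) / 2, (s + x.2 - x.1) / 2)) ?_ ?_ ?_ ?_ ?_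
  · rintro ⟨i, j⟩ h
    simp only [Finset.mem_product, Finset.mem_range, Finset.mem_filter, EvenTriangleRule,
      Nat.even_iff] at *
    omega
  · rintro ⟨i, j⟩ h
    simp only [Finset.mem_product, Finset.mem_range, Finset.mem_filter, EvenTriangleRule,
      Nat.even_iff] at *
    omega
  · rintro ⟨i, j⟩ h
    simp only [Finset.mem_product, Finset.mem_range, Prod.mk.injEq] at *
    omega
  · rintro ⟨i, j⟩ h
    simp only [Finset.mem_product, Finset.mem_range, Finset.mem_filter, EvenTriangleRule,
      Nat.even_iff, Prod.mk.injEq] at *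
    omega
  · intros; rfl

/-- The pairs (b, c) split by the parity of the perimeter. Even perimeters give the rectangle with b
= s + i - j and c = i + j. Odd ones use c = i + j + 1, where c ≤ s + b becomes j < s and the
perimeter is 2s + 2i + 1. -/
theorem fusionConv_one_triangleRule (t s : ℕ) (hs : s ≤ t / 2) (g : ℕ → ℕ) :
    fusionConv (t / 2) (TriangleRule t) (fun _ => 1) g s =
      ∑ i ∈ Finset.range (t / 2 - s + 1), ∑ j ∈ Finset.range (s + 1), g (i + j) +
        ∑ i ∈ Finset.range ((t + 1) / 2 - s), ∑ j ∈ Finset.range s, g (i + j + 1) := by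
  classical
  rw [fusionConv_one, ← Finset.sum_product', ← Finset.sum_product']
  refine (Finset.sum_filter_add_sum_filter_not _ (fun x => Even (s + x.1 + x.2)) _).symm.trans ?_
  congr 1 <;> symm
  · refine Finset.sum_nbij' (fun x => (s + x.1 - x.2, x.1 + x.2))
      (fun x => ((x.1 + x.2 - s) / 2, (s + x.2 - x.1) / 2)) ?_ ?_ ?_ ?_ ?_
    · rintro ⟨i, j⟩ h
      simp only [Finset.mem_product, Finset.mem_range, Finset.mem_filter, Nat.even_iff] at *
      simp only [TriangleRule] at *
      omega
    · rintro ⟨i, j⟩ h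
      simp only [Finset.mem_product, Finset.mem_range, Finset.mem_filter, Nat.even_iff] at *
      simp only [TriangleRule] at *
      omega
    · rintro ⟨i, j⟩ h
      simp only [Finset.mem_product, Finset.mem_range, Prod.mk.injEq] at *
      omega
    · rintro ⟨i, j⟩ h
      simp only [Finset.mem_product, Finset.mem_range, Finset.mem_filter, Nat.even_iff,
        Prod.mk.injEq] at *
      simp only [TriangleRule] at *
      omega
    · intros; rfl
  · refine Finset.sum_nbij' (fun x => (s + x.1 - x.2, x.1 + x.2 + 1))
      (fun x => ((x.1 + x.2 - s) / 2, (s + x.2 - x.1) / 2)) ?_ ?_ ?_ ?_ ?_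
    · rintro ⟨i, j⟩ h
      simp only [Finset.mem_product, Finset.mem_range, Finset.mem_filter, Nat.even_iff] at *
      simp only [TriangleRule] at *
      omega
    · rintro ⟨i, j⟩ h
      simp only [Finset.mem_product, Finset.mem_range, Finset.mem_filter, Nat.even_iff] at *
      simp only [TriangleRule] at *
      omega
    · rintro ⟨i, j⟩ h
      simp only [Finset.mem_product, Finset.mem_range, Prod.mk.injEq] at *
      omega
    · rintro ⟨i, j⟩ h
      simp only [Finset.mem_product, Finset.mem_range, Finset.mem_filter, Nat.even_iff,
        Prod.mk.injEq] at *
      simp only [TriangleRule] at *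
      omega
    · intros; rfl

/-! ### Solutions of the discrete Dirichlet problems -/

/-- The combination of central factorials with `∑ k, centralSum a κ k y * u ^ k` equal to the
product of the series `∑ i, a i * u ^ i` and `∑ j, centralFactorial j y * (κ u) ^ j`. -/
noncomputable def centralSum (a : ℕ → ℝ) (κ : ℝ) (k : ℕ) (y : ℝ) : ℝ :=
  ∑ p ∈ Finset.HasAntidiagonal.antidiagonal k, a p.1 * (κ ^ p.2 * (centralFactorial p.2).eval y)

theorem centralSum_zero (a : ℕ → ℝ) (κ y : ℝ) : centralSum a κ 0 y = a 0 := by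
  simp [centralSum, centralFactorial_zero_eval]

theorem centralSum_neg (a : ℕ → ℝ) (κ : ℝ) (k : ℕ) (y : ℝ) :
    centralSum a κ k (-y) = centralSum a κ k y := by
  simp only [centralSum, centralFactorial_eval_neg]

theorem centralSum_second_difference (a : ℕ → ℝ) (κ : ℝ) (k : ℕ) (y : ℝ) :
    centralSum a κ (k + 1) (y + 1) - 2 * centralSum a κ (k + 1) y + centralSum a κ (k + 1) (y - 1) =
      κ * centralSum a κ k y := by
  unfold centralSum
  simp only [Finset.Nat.sum_antidiagonal_succ', centralFactorial_zero_eval]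
  have hsplit : ∀ A S₁ S₂ S₃ : ℝ, A + S₁ - 2 * (A + S₂) + (A + S₃) = S₁ - 2 * S₂ + S₃ := by
    intros; ring
  rw [hsplit, Finset.mul_sum, Finset.mul_sum, ← Finset.sum_sub_distrib, ← Finset.sum_add_distrib]
  refine Finset.sum_congr rfl fun p _ => ?_
  rw [← (centralFactorial_differences p.2 y).1]
  ring

/-- The hypothesis `ha` is the Dirichlet condition at s = -1, hence by evenness also at s = t + 1.
Two corners of the rectangle then vanish, and the other two are equal by symmetry. -/
theorem fusionPow_evenTriangleRule {a : ℕ → ℝ} (t : ℕ) (ha0 : a 0 = 1)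
    (ha : ∀ k, centralSum a (-2) (k + 1) (t / 2 + 1) = 0) (k : ℕ) :
    ∀ s ≤ t, (fusionPow t (EvenTriangleRule t) k s : ℝ) = centralSum a (-2) k (t / 2 - s) := by
  induction k with
  | zero => intro s _; simp [fusionPow, centralSum_zero, ha0]
  | succ k ih =>
    intro s hs
    rw [fusionPow, fusionConv_one_evenTriangleRule t s hs]
    push_cast
    -- The index is n = s + 1, so the boundary point s = -1 becomes n = 0.
    set V : ℕ → ℝ := fun n => centralSum a (-2) (k + 1) (t / 2 + 1 - n) with hV
    have hsum := sum_range_sum_range_second_difference V (t - s + 1) (s + 1)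
    have hrw : ∑ i ∈ Finset.range (t - s + 1), ∑ j ∈ Finset.range (s + 1),
        (V (i + j + 2) - 2 * V (i + j + 1) + V (i + j)) =
        (-2) * ∑ i ∈ Finset.range (t - s + 1), ∑ j ∈ Finset.range (s + 1),
          (fusionPow t (EvenTriangleRule t) k (i + j) : ℝ) := by
      simp only [Finset.mul_sum]
      refine Finset.sum_congr rfl fun i hi => Finset.sum_congr rfl fun j hj => ?_
      rw [Finset.mem_range] at hi hj
      rw [ih (i + j) (by omega), ← centralSum_second_difference]
      simp only [hV]
      push_cast
      rw [show (t : ℝ) / 2 + 1 - (i + j + 2) = t / 2 - (i + j) - 1 by ring,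
        show (t : ℝ) / 2 + 1 - (i + j + 1) = t / 2 - (i + j) by ring,
        show (t : ℝ) / 2 + 1 - (i + j) = t / 2 - (i + j) + 1 by ring]
      ring
    rw [hrw] at hsum
    have h0 : V 0 = 0 := by simp [hV, ha]
    have h1 : V (t - s + 1 + (s + 1)) = 0 := by
      rw [show t - s + 1 + (s + 1) = t + 2 by omega, hV]
      simp only
      push_cast
      rw [show (t : ℝ) / 2 + 1 - (t + 2) = -(t / 2 + 1) by ring, centralSum_neg, ha]
    have h2 : V (s + 1) = centralSum a (-2) (k + 1) (t / 2 - s) := by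
      simp only [hV]; push_cast; congr 1; ring
    have h3 : V (t - s + 1) = centralSum a (-2) (k + 1) (t / 2 - s) := by
      simp only [hV]
      rw [← centralSum_neg]
      push_cast [Nat.cast_sub hs]
      congr 1; ring
    rw [h0, h1, h2, h3] at hsum
    linarith

/-- The two rectangles telescope separately, to 2 V 0 - 2 V (s+1) and 2 V 1 - 2 V (s+1). Only V 0 +
V 1 has to vanish, and the total -4 V (s+1) explains κ = -4. -/
theorem fusionPow_triangleRule_even {a : ℕ → ℝ} (t : ℕ) (ht : Even t) (ha0 : a 0 = 1)
    (ha : ∀ k, centralSum a (-4) (k + 1) (t / 4 + 1) + centralSum a (-4) (k + 1) (t / 4) = 0)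
    (k : ℕ) : ∀ s ≤ t / 2,
      (fusionPow (t / 2) (TriangleRule t) k s : ℝ) = centralSum a (-4) k (t / 4 - s) := by
  obtain ⟨m, rfl⟩ := ht
  have hm : (m + m) / 2 = m := by omega
  have hm' : (m + m + 1) / 2 = m := by omega
  have hmc : ((m + m : ℕ) : ℝ) / 4 = m / 2 := by push_cast; ring
  rw [hmc] at ha
  rw [hm, hmc]
  induction k with
  | zero => intro s _; simp [fusionPow, centralSum_zero, ha0]
  | succ k ih =>
    intro s hs
    have hconv := fusionConv_one_triangleRule (m + m) s (by omega)
      (fusionPow m (TriangleRule (m + m)) k)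
    rw [hm, hm'] at hconv
    rw [fusionPow, hconv]
    push_cast
    set V : ℕ → ℝ := fun n => centralSum a (-4) (k + 1) (m / 2 + 1 - n) with hV
    have hV' : ∀ n, V n - 2 * V (n + 1) + V (n + 2) =
        (-4) * centralSum a (-4) k (m / 2 - n) := by
      intro n
      rw [← centralSum_second_difference]
      simp only [hV]
      push_cast
      rw [show (m : ℝ) / 2 + 1 - (n + 2) = m / 2 - n - 1 by ring,
        show (m : ℝ) / 2 + 1 - (n + 1) = m / 2 - n by ring,
        show (m : ℝ) / 2 + 1 - n = m / 2 - n + 1 by ring]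
    have hsum := sum_range_sum_range_second_difference V (m - s + 1) (s + 1)
    have hsum' := sum_range_sum_range_second_difference (fun n => V (n + 1)) (m - s) s
    have hrw : ∑ i ∈ Finset.range (m - s + 1), ∑ j ∈ Finset.range (s + 1),
        (V (i + j + 2) - 2 * V (i + j + 1) + V (i + j)) =
        (-4) * ∑ i ∈ Finset.range (m - s + 1), ∑ j ∈ Finset.range (s + 1),
          (fusionPow m (TriangleRule (m + m)) k (i + j) : ℝ) := by
      simp only [Finset.mul_sum]
      refine Finset.sum_congr rfl fun i hi => Finset.sum_congr rfl fun j hj => ?_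
      rw [Finset.mem_range] at hi hj
      rw [ih (i + j) (by omega), ← hV']
      ring
    have hrw' : ∑ i ∈ Finset.range (m - s), ∑ j ∈ Finset.range s,
        (V (i + j + 2 + 1) - 2 * V (i + j + 1 + 1) + V (i + j + 1)) =
        (-4) * ∑ i ∈ Finset.range (m - s), ∑ j ∈ Finset.range s,
          (fusionPow m (TriangleRule (m + m)) k (i + j + 1) : ℝ) := by
      simp only [Finset.mul_sum]
      refine Finset.sum_congr rfl fun i hi => Finset.sum_congr rfl fun j hj => ?_
      rw [Finset.mem_range] at hi hj
      rw [ih (i + j + 1) (by omega), ← hV']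
      ring
    rw [hrw] at hsum
    rw [hrw'] at hsum'
    have hsymm : ∀ n ≤ m + 2, V (m + 2 - n) = V n := by
      intro n hn
      simp only [hV]
      rw [← centralSum_neg]
      push_cast [Nat.cast_sub hn]
      congr 1; ring
    have h01 : V 0 + V 1 = 0 := by
      have := ha k
      simp only [hV]
      rw [← this]
      norm_num
    have h1 : V (m - s + 1 + (s + 1)) = V 0 := by
      rw [← hsymm 0 (by omega)]; congr 1; omega
    have h2 : V (m - s + s + 1) = V 1 := by
      rw [← hsymm 1 (by omega)]; congr 1; omega
    have h3 : V (m - s + 1) = V (s + 1) := by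
      rw [← hsymm (s + 1) (by omega)]; congr 1; omega
    have h4 : V (s + 1) = centralSum a (-4) (k + 1) (m / 2 - s) := by
      simp only [hV]; push_cast; congr 1; ring
    rw [h1, h3] at hsum
    rw [h2, h3, zero_add] at hsum'
    rw [← h4]
    linarith

/-- Place the label s at the point 2s of 0, …, t. Both rectangles together are the even points of
one larger rectangle; as t is odd, reflection exchanges parities, so they carry half of its full
sum. This halving turns κ into -1. -/
theorem fusionPow_triangleRule_odd {a : ℕ → ℝ} (t : ℕ) (ht : Odd t) (ha0 : a 0 = 1)
    (ha : ∀ k, centralSum a (-1) (k + 1) (t / 2 + 1) = 0) (k : ℕ) : ∀ s ≤ t / 2,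
      (fusionPow (t / 2) (TriangleRule t) k s : ℝ) = centralSum a (-1) k (t / 2 - 2 * s) := by
  obtain ⟨m, hm⟩ := ht
  induction k with
  | zero => intro s _; simp [fusionPow, centralSum_zero, ha0]
  | succ k ih =>
    intro s hs
    rw [fusionPow, fusionConv_one_triangleRule t s hs]
    push_cast
    set f : ℕ → ℝ := fun n => centralSum a (-1) k (t / 2 - n) with hf
    have hfs : ∀ n ≤ t, f (t - n) = f n := by
      intro n hn
      simp only [hf]
      rw [← centralSum_neg]
      push_cast [Nat.cast_sub hn]
      congr 1; ring
    have hp : (t + 1) / 2 - s = t / 2 - s + 1 := by omega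
    have hbox := two_mul_sum_even_eq_sum_rectangle f (p := t / 2 - s + 1) (q := s) hfs (by omega)
    set V : ℕ → ℝ := fun n => centralSum a (-1) (k + 1) (t / 2 + 1 - n) with hV
    have hsum := sum_range_sum_range_second_difference V (2 * (t / 2 - s + 1)) (2 * s + 1)
    have hV' : ∀ n, V (n + 2) - 2 * V (n + 1) + V n = (-1) * f n := by
      intro n
      simp only [hf]
      rw [← centralSum_second_difference]
      simp only [hV]
      push_cast
      rw [show (t : ℝ) / 2 + 1 - (n + 2) = t / 2 - n - 1 by ring,
        show (t : ℝ) / 2 + 1 - (n + 1) = t / 2 - n by ring,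
        show (t : ℝ) / 2 + 1 - n = t / 2 - n + 1 by ring]
      ring
    simp only [hV', ← Finset.mul_sum] at hsum
    rw [← hbox] at hsum
    have e1 : ∑ i ∈ Finset.range (t / 2 - s + 1), ∑ j ∈ Finset.range (s + 1),
        (fusionPow (t / 2) (TriangleRule t) k (i + j) : ℝ) =
        ∑ i ∈ Finset.range (t / 2 - s + 1), ∑ j ∈ Finset.range (s + 1), f (2 * i + 2 * j) := by
      refine Finset.sum_congr rfl fun i hi => Finset.sum_congr rfl fun j hj => ?_
      rw [Finset.mem_range] at hi hj
      rw [ih (i + j) (by omega)]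
      simp only [hf]; push_cast; congr 1; ring
    have e2 : ∑ i ∈ Finset.range (t / 2 - s + 1), ∑ j ∈ Finset.range s,
        (fusionPow (t / 2) (TriangleRule t) k (i + j + 1) : ℝ) =
        ∑ i ∈ Finset.range (t / 2 - s + 1), ∑ j ∈ Finset.range s, f (2 * i + 2 * j + 2) := by
      refine Finset.sum_congr rfl fun i hi => Finset.sum_congr rfl fun j hj => ?_
      rw [Finset.mem_range] at hi hj
      rw [ih (i + j + 1) (by omega)]
      simp only [hf]; push_cast; congr 1; ring
    rw [hp, e1, e2]
    have h0 : V 0 = 0 := by simp [hV, ha]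
    have h1 : V (2 * (t / 2 - s + 1) + (2 * s + 1)) = 0 := by
      rw [show 2 * (t / 2 - s + 1) + (2 * s + 1) = t + 2 by omega, hV]
      simp only
      push_cast
      rw [show (t : ℝ) / 2 + 1 - (t + 2) = -(t / 2 + 1) by ring, centralSum_neg, ha]
    have h2 : V (2 * s + 1) = centralSum a (-1) (k + 1) (t / 2 - 2 * s) := by
      simp only [hV]; push_cast; congr 1; ring
    have h3 : V (2 * (t / 2 - s + 1)) = V (2 * s + 1) := by
      rw [show 2 * (t / 2 - s + 1) = t + 1 - 2 * s by omega]
      simp only [hV]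
      rw [← centralSum_neg]
      push_cast [Nat.cast_sub (show 2 * s ≤ t + 1 by omega)]
      congr 1; ring
    rw [h0, h1, h3, h2] at hsum
    linarith

/-! ### Polynomiality in the level -/

/-- The coefficients of the inverse of the power series `∑ j, b j * u ^ j`, where `b 0 = 1`. -/
noncomputable def inverseSeq {R : Type*} [CommRing R] (b : ℕ → R) (i : ℕ) : R :=
  PowerSeries.coeff i (PowerSeries.invOfUnit (PowerSeries.mk b) 1)

theorem inverseSeq_zero {R : Type*} [CommRing R] (b : ℕ → R) : inverseSeq b 0 = 1 := by
  simp [inverseSeq]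

theorem sum_inverseSeq_mul {R : Type*} [CommRing R] {b : ℕ → R} (hb : b 0 = 1) (k : ℕ) :
    ∑ p ∈ Finset.HasAntidiagonal.antidiagonal (k + 1), inverseSeq b p.1 * b p.2 = 0 := by
  have h := PowerSeries.invOfUnit_mul (PowerSeries.mk b) 1
    (by rw [← PowerSeries.coeff_zero_eq_constantCoeff_apply]; simp [hb])
  have h' := congrArg (PowerSeries.coeff (k + 1)) h
  rw [PowerSeries.coeff_mul, PowerSeries.coeff_one, if_neg (Nat.succ_ne_zero k)] at h'
  simpa [inverseSeq] using h'

open Polynomial in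
/-- The polynomial `κ ^ j * centralFactorial j (r X + d)`. -/
noncomputable def scaledFactorial (κ r d : ℝ) (j : ℕ) : ℝ[X] :=
  C (κ ^ j) * (centralFactorial j).comp (C r * X + C d)

theorem scaledFactorial_zero (κ r d : ℝ) : scaledFactorial κ r d 0 = 1 := by
  simp [scaledFactorial, centralFactorial]

theorem scaledFactorial_eval (κ r d : ℝ) (j : ℕ) (x : ℝ) :
    (scaledFactorial κ r d j).eval x = κ ^ j * (centralFactorial j).eval (r * x + d) := by
  simp [scaledFactorial]

open Polynomial in
/-- The polynomial in `t` whose values are `centralSum (fun i => (a i).eval t) κ k (r t + d)`. -/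
noncomputable def centralSumPolynomial (a : ℕ → ℝ[X]) (κ r d : ℝ) (k : ℕ) : ℝ[X] :=
  ∑ p ∈ Finset.HasAntidiagonal.antidiagonal k, a p.1 * scaledFactorial κ r d p.2

theorem centralSumPolynomial_eval (a : ℕ → Polynomial ℝ) (κ r d : ℝ) (k : ℕ) (x : ℝ) :
    (centralSumPolynomial a κ r d k).eval x =
      centralSum (fun i => (a i).eval x) κ k (r * x + d) := by
  simp [centralSumPolynomial, centralSum, Polynomial.eval_finsetSum, scaledFactorial_eval]

/-- Taking a as the inverse series makes the product at the boundary point r x + d equal to 1, so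
all higher coefficients vanish. -/
theorem centralSum_inverseSeq_scaledFactorial (κ r d x : ℝ) (k : ℕ) :
    centralSum (fun i => (inverseSeq (scaledFactorial κ r d) i).eval x) κ (k + 1) (r * x + d) =
      0 := by
  rw [← centralSumPolynomial_eval, centralSumPolynomial,
    sum_inverseSeq_mul (scaledFactorial_zero κ r d), Polynomial.eval_zero]

theorem exists_polynomial_fusionPow_evenTriangleRule (k : ℕ) :
    ∃ p : Polynomial ℝ, ∀ t : ℕ,
      (fusionPow t (EvenTriangleRule t) (k + 1) 0 : ℝ) = p.eval (t : ℝ) := by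
  refine ⟨centralSumPolynomial (inverseSeq (scaledFactorial (-2) (1 / 2) 1)) (-2) (1 / 2) 0 (k + 1),
    fun t => ?_⟩
  rw [centralSumPolynomial_eval, fusionPow_evenTriangleRule
    (a := fun i => (inverseSeq (scaledFactorial (-2) (1 / 2) 1) i).eval (t : ℝ)) t
    (by simp [inverseSeq_zero]) ?_ _ _ (Nat.zero_le t)]
  · congr 1; push_cast; ring
  · intro k
    rw [← centralSum_inverseSeq_scaledFactorial (-2) (1 / 2) 1 t k]
    congr 1; ring

theorem exists_polynomial_fusionPow_triangleRule_odd (k : ℕ) :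
    ∃ p : Polynomial ℝ, (∀ t : ℕ, Odd t →
      (fusionPow (t / 2) (TriangleRule t) (k + 1) 0 : ℝ) = p.eval (t : ℝ)) ∧ p.eval (-1) = 0 := by
  refine ⟨centralSumPolynomial (inverseSeq (scaledFactorial (-1) (1 / 2) 1)) (-1) (1 / 2) 0 (k + 1),
    fun t ht => ?_, ?_⟩
  · rw [centralSumPolynomial_eval, fusionPow_triangleRule_odd
      (a := fun i => (inverseSeq (scaledFactorial (-1) (1 / 2) 1) i).eval (t : ℝ)) t ht
      (by simp [inverseSeq_zero]) ?_ _ _ (Nat.zero_le _)]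
    · congr 1; push_cast; ring
    · intro k
      rw [← centralSum_inverseSeq_scaledFactorial (-1) (1 / 2) 1 t k]
      congr 1; ring
  -- At t = -1 the evaluation point is -1/2; evenness moves it to 1/2 = t/2 + 1, the Dirichlet
  -- boundary.
  · rw [centralSumPolynomial_eval, ← centralSum_neg]
    refine Eq.trans ?_ (centralSum_inverseSeq_scaledFactorial (-1) (1 / 2) 1 (-1) k)
    congr 1; ring

/-! ### Sign of the even constituent at t = -1 -/

/-- The value `-(-4) ^ (j + 1) * centralFactorial (j + 1) y`, which is positive for `0 < y < 1`. -/
noncomputable def negScaledValue (j : ℕ) (y : ℝ) : ℝ :=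
  -((-4) ^ (j + 1) * (centralFactorial (j + 1)).eval y)

theorem negScaledValue_zero (y : ℝ) : negScaledValue 0 y = 2 * y ^ 2 := by
  simp [negScaledValue, centralFactorial_succ_eval, centralFactorial_zero_eval]
  ring

theorem negScaledValue_succ (j : ℕ) (y : ℝ) :
    negScaledValue (j + 1) y =
      negScaledValue j y * (4 * ((j + 1) ^ 2 - y ^ 2) / ((2 * j + 4) * (2 * j + 3))) := by
  rw [negScaledValue, centralFactorial_succ_eval (j + 1), negScaledValue]
  push_cast
  field_simp
  ring

theorem negScaledValue_pos {y : ℝ} (hy : 0 < y) (hy1 : y < 1) (j : ℕ) : 0 < negScaledValue j y := by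
  induction j with
  | zero => rw [negScaledValue_zero]; positivity
  | succ j ih =>
    rw [negScaledValue_succ]
    have : 0 < ((j : ℝ) + 1) ^ 2 - y ^ 2 := by
      have : (0 : ℝ) ≤ j := j.cast_nonneg
      nlinarith
    positivity

/-- The quotient of the values at 3/4 and 1/4 starts at 9 and decreases with j, so being larger than
1 does not propagate by itself. The explicit bound (j + 9/2)/(j + 1/2) is exact at j = 0, falls fast
enough for the induction and stays above 1. -/
theorem negScaledValue_ratio (j : ℕ) :
    ((j : ℝ) + 9 / 2) * negScaledValue j (1 / 4) ≤ (j + 1 / 2) * negScaledValue j (3 / 4) := by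
  induction j with
  | zero => rw [negScaledValue_zero, negScaledValue_zero]; norm_num
  | succ j ih =>
    have hj : (0 : ℝ) ≤ j := j.cast_nonneg
    have hx := negScaledValue_pos (y := 1 / 4) (by norm_num) (by norm_num) j
    rw [negScaledValue_succ, negScaledValue_succ]
    generalize negScaledValue j (1 / 4) = x at *
    generalize negScaledValue j (3 / 4) = z at *
    have hz : (j + 9 / 2) / (j + 1 / 2) * x ≤ z := by
      rw [div_mul_eq_mul_div, div_le_iff₀ (by positivity)]; linarith
    push_cast
    have hc : 0 ≤ (((j : ℝ) + 1) ^ 2 - (3 / 4) ^ 2) := by nlinarith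
    have hmain : ((j : ℝ) + 11 / 2) * (((j : ℝ) + 1) ^ 2 - (1 / 4) ^ 2) ≤
        (j + 3 / 2) * (((j : ℝ) + 1) ^ 2 - (3 / 4) ^ 2) * ((j + 9 / 2) / (j + 1 / 2)) := by
      rw [mul_div_assoc', le_div_iff₀ (by positivity)]
      nlinarith [mul_nonneg hj hj]
    have hfin : ((j : ℝ) + 11 / 2) * (((j : ℝ) + 1) ^ 2 - (1 / 4) ^ 2) * x ≤
        (j + 3 / 2) * (((j : ℝ) + 1) ^ 2 - (3 / 4) ^ 2) * z := by
      calc _ ≤ (j + 3 / 2) * (((j : ℝ) + 1) ^ 2 - (3 / 4) ^ 2) * ((j + 9 / 2) / (j + 1 / 2)) * x :=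
            mul_le_mul_of_nonneg_right hmain hx.le
        _ = (j + 3 / 2) * (((j : ℝ) + 1) ^ 2 - (3 / 4) ^ 2) * ((j + 9 / 2) / (j + 1 / 2) * x) := by
            ring
        _ ≤ _ := mul_le_mul_of_nonneg_left hz (by positivity)
    have hD : (0 : ℝ) < 4 / ((2 * j + 4) * (2 * j + 3)) := by positivity
    have := mul_le_mul_of_nonneg_right hfin hD.le
    calc _ = ((j : ℝ) + 11 / 2) * (((j : ℝ) + 1) ^ 2 - (1 / 4) ^ 2) * x *
          (4 / ((2 * j + 4) * (2 * j + 3))) := by ring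
      _ ≤ _ := this
      _ = _ := by ring

theorem negScaledValue_lt (j : ℕ) : negScaledValue j (1 / 4) < negScaledValue j (3 / 4) := by
  have hx := negScaledValue_pos (y := 1 / 4) (by norm_num) (by norm_num) j
  have h := negScaledValue_ratio j
  have hj : (0 : ℝ) < j + 1 / 2 := by positivity
  by_contra! hcon
  nlinarith

theorem centralSum_succ_eq_sub (α : ℕ → ℝ) (k : ℕ) (y : ℝ) :
    centralSum α (-4) (k + 1) y = α (k + 1) -
      ∑ p ∈ Finset.HasAntidiagonal.antidiagonal k, α p.1 * negScaledValue p.2 y := by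
  rw [centralSum, Finset.Nat.sum_antidiagonal_succ', centralFactorial_zero_eval, sub_eq_add_neg,
    ← Finset.sum_neg_distrib]
  congr 1
  · simp
  · exact Finset.sum_congr rfl fun p _ => by rw [negScaledValue]; ring

/-- By `h`, α (k+1) is the mean of two sums with positive terms, so all α are positive. As the
subtracted values are smaller at 1/4 than at 3/4, the central sum is larger at 1/4; the two being
opposite, it is positive there. -/
theorem centralSum_quarter_pos {α : ℕ → ℝ} (h0 : α 0 = 1)
    (h : ∀ k, centralSum α (-4) (k + 1) (3 / 4) + centralSum α (-4) (k + 1) (1 / 4) = 0) (k : ℕ) :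
    0 < centralSum α (-4) (k + 1) (1 / 4) := by
  simp only [centralSum_succ_eq_sub] at h ⊢
  have hne : ∀ k : ℕ, (Finset.HasAntidiagonal.antidiagonal k).Nonempty := fun k =>
    ⟨(0, k), by simp⟩
  have hpos : ∀ i, 0 < α i := by
    intro i
    induction i using Nat.strong_induction_on with
    | _ i ih =>
      obtain _ | i := i
      · rw [h0]; exact one_pos
      · have hs : ∀ y : ℝ, 0 < y → y < 1 →
            0 < ∑ p ∈ Finset.HasAntidiagonal.antidiagonal i, α p.1 * negScaledValue p.2 y := by
          intro y hy hy1
          refine Finset.sum_pos (fun p hp => mul_pos (ih _ ?_) (negScaledValue_pos hy hy1 _)) (hne i)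
          have := Finset.HasAntidiagonal.mem_antidiagonal.mp hp
          omega
        have h1 := hs (1 / 4) (by norm_num) (by norm_num)
        have h2 := hs (3 / 4) (by norm_num) (by norm_num)
        linarith [h i]
  have hlt : ∑ p ∈ Finset.HasAntidiagonal.antidiagonal k, α p.1 * negScaledValue p.2 (1 / 4) <
      ∑ p ∈ Finset.HasAntidiagonal.antidiagonal k, α p.1 * negScaledValue p.2 (3 / 4) :=
    Finset.sum_lt_sum_of_nonempty (hne k) fun p _ =>
      mul_lt_mul_of_pos_left (negScaledValue_lt _) (hpos _)
  linarith [h k]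

open Polynomial in
/-- The arithmetic mean of `scaledFactorial κ r d` and `scaledFactorial κ r d'`. -/
noncomputable def meanScaledFactorial (κ r d d' : ℝ) (j : ℕ) : ℝ[X] :=
  C (1 / 2) * (scaledFactorial κ r d j + scaledFactorial κ r d' j)

theorem centralSum_inverseSeq_meanScaledFactorial (κ r d d' x : ℝ) (k : ℕ) :
    centralSum (fun i => (inverseSeq (meanScaledFactorial κ r d d') i).eval x) κ (k + 1)
        (r * x + d) +
      centralSum (fun i => (inverseSeq (meanScaledFactorial κ r d d') i).eval x) κ (k + 1)
        (r * x + d') = 0 := by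
  have h0 : meanScaledFactorial κ r d d' 0 = 1 := by
    rw [meanScaledFactorial, scaledFactorial_zero, scaledFactorial_zero, one_add_one_eq_two,
      show (2 : Polynomial ℝ) = Polynomial.C 2 from rfl, ← Polynomial.C_mul]
    norm_num
  have h := congrArg (Polynomial.eval x) (sum_inverseSeq_mul h0 k)
  rw [Polynomial.eval_zero, Polynomial.eval_finsetSum] at h
  rw [← mul_zero 2, ← h, centralSum, centralSum, ← Finset.sum_add_distrib, Finset.mul_sum]
  refine Finset.sum_congr rfl fun p _ => ?_
  rw [Polynomial.eval_mul, meanScaledFactorial, Polynomial.eval_mul, Polynomial.eval_add,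
    scaledFactorial_eval, scaledFactorial_eval, Polynomial.eval_C]
  ring

theorem exists_polynomial_fusionPow_triangleRule_even (k : ℕ) :
    ∃ p : Polynomial ℝ, (∀ t : ℕ, Even t →
      (fusionPow (t / 2) (TriangleRule t) (k + 1) 0 : ℝ) = p.eval (t : ℝ)) ∧ 0 < p.eval (-1) := by
  refine ⟨centralSumPolynomial (inverseSeq (meanScaledFactorial (-4) (1 / 4) 1 0)) (-4) (1 / 4) 0
    (k + 1), fun t ht => ?_, ?_⟩
  · rw [centralSumPolynomial_eval, fusionPow_triangleRule_even
      (a := fun i => (inverseSeq (meanScaledFactorial (-4) (1 / 4) 1 0) i).eval (t : ℝ)) t ht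
      (by simp [inverseSeq_zero]) ?_ _ _ (Nat.zero_le _)]
    · congr 1; push_cast; ring
    · intro k
      refine Eq.trans ?_ (centralSum_inverseSeq_meanScaledFactorial (-4) (1 / 4) 1 0 t k)
      rw [one_div_mul_eq_div, add_zero]
  · rw [centralSumPolynomial_eval, ← centralSum_neg,
      show -((1 : ℝ) / 4 * -1 + 0) = 1 / 4 by norm_num]
    refine centralSum_quarter_pos (by simp [inverseSeq_zero]) (fun k => ?_) k
    refine Eq.trans ?_ (centralSum_inverseSeq_meanScaledFactorial (-4) (1 / 4) 1 0 (-1) k)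
    rw [show (1 : ℝ) / 4 * -1 + 1 = 3 / 4 by norm_num,
      show (1 : ℝ) / 4 * -1 + 0 = -(1 / 4) by norm_num, centralSum_neg]

/-! ### Labelings of rooted binary trees -/

/-- A rooted tree on `V`, given by the parent and the depth of every node; the root has depth `0`.
Every node other than the root has either no child or exactly two. -/
structure RootedBinary (V : Type*) where
  parent : V → V
  depth : V → ℕ
  depth_parent : ∀ v, depth (parent v) = depth v - 1
  children : ∀ v, depth v ≠ 0 → (∀ c, depth c ≠ 0 → parent c ≠ v) ∨
    ∃ c₁ c₂, c₁ ≠ c₂ ∧ (depth c₁ ≠ 0 ∧ parent c₁ = v) ∧ (depth c₂ ≠ 0 ∧ parent c₂ = v) ∧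
      ∀ c, depth c ≠ 0 → parent c = v → c = c₁ ∨ c = c₂

namespace RootedBinary

variable {V : Type*} (R : RootedBinary V)

/-- `c` is a child of `v`. -/
def IsChild (c v : V) : Prop := R.depth c ≠ 0 ∧ R.parent c = v

/-- The descendants of `v`, including `v`. -/
def branch (v : V) : Set V := {x | ∃ i, R.parent^[i] x = v}

/-- Labels at most `M` at every node of `S`, with the relation `N` between the label of a node
of `S` and the labels of its two children. -/
def IsLabeling (M : ℕ) (N : ℕ → ℕ → ℕ → Prop) (S : Set V) (w : V → ℕ) : Prop :=
  (∀ x ∈ S, w x ≤ M) ∧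
    ∀ x ∈ S, ∀ c₁ c₂, c₁ ≠ c₂ → R.IsChild c₁ x → R.IsChild c₂ x → N (w x) (w c₁) (w c₂)

/-- The labelings of the branch at `v` that give the label `s` to `v`, extended by `0`. -/
def labelings (M : ℕ) (N : ℕ → ℕ → ℕ → Prop) (v : V) (s : ℕ) : Set (V → ℕ) :=
  {w | (∀ x ∉ R.branch v, w x = 0) ∧ w v = s ∧ R.IsLabeling M N (R.branch v) w}

theorem depth_iterate (i : ℕ) (x : V) : R.depth (R.parent^[i] x) = R.depth x - i := by
  induction i with
  | zero => rfl
  | succ i ih => rw [Function.iterate_succ_apply', R.depth_parent, ih]; omega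

theorem self_mem_branch (v : V) : v ∈ R.branch v := ⟨0, rfl⟩

theorem depth_le_of_mem_branch {v x : V} (hx : x ∈ R.branch v) : R.depth v ≤ R.depth x := by
  obtain ⟨i, rfl⟩ := hx
  rw [R.depth_iterate]
  omega

theorem branch_child_subset {c v : V} (hc : R.IsChild c v) : R.branch c ⊆ R.branch v := by
  rintro x ⟨i, rfl⟩
  exact ⟨i + 1, by rw [Function.iterate_succ_apply', hc.2]⟩

theorem depth_child {c v : V} (hc : R.IsChild c v) : R.depth c = R.depth v + 1 := by
  have := R.depth_parent c
  rw [hc.2] at this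
  have := hc.1
  omega

theorem not_mem_branch_child {c v : V} (hc : R.IsChild c v) : v ∉ R.branch c := by
  intro h
  have := R.depth_le_of_mem_branch h
  rw [R.depth_child hc] at this
  omega

theorem disjoint_branch_child {c₁ c₂ v : V} (h : c₁ ≠ c₂) (h₁ : R.IsChild c₁ v)
    (h₂ : R.IsChild c₂ v) : Disjoint (R.branch c₁) (R.branch c₂) := by
  rw [Set.disjoint_left]
  rintro x ⟨i, hi⟩ ⟨j, hj⟩
  have h3 := R.depth_iterate i x
  have h4 := R.depth_iterate j x
  rw [hi, R.depth_child h₁] at h3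
  rw [hj, R.depth_child h₂] at h4
  have : i = j := by omega
  subst this
  exact h (hi.symm.trans hj)

theorem mem_branch_iff {v : V} (hv : R.depth v ≠ 0) (x : V) :
    x ∈ R.branch v ↔ x = v ∨ ∃ c, R.IsChild c v ∧ x ∈ R.branch c := by
  constructor
  · rintro ⟨i, hi⟩
    obtain _ | i := i
    · exact Or.inl hi
    · rw [Function.iterate_succ_apply'] at hi
      refine Or.inr ⟨R.parent^[i] x, ⟨?_, hi⟩, i, rfl⟩
      intro h0
      have := R.depth_parent (R.parent^[i] x)
      rw [hi, h0] at this
      omega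
  · rintro (rfl | ⟨c, hc, hx⟩)
    · exact R.self_mem_branch x
    · exact R.branch_child_subset hc hx

theorem mem_branch_of_isChild {c x v : V} (hx : x ∈ R.branch v) (hc : R.IsChild c x) :
    c ∈ R.branch v := by
  obtain ⟨i, rfl⟩ := hx
  exact ⟨i + 1, by rw [Function.iterate_succ_apply, hc.2]⟩

theorem IsLabeling.congr {R : RootedBinary V} {M : ℕ} {N : ℕ → ℕ → ℕ → Prop} {v : V} {w w' : V → ℕ}
    (h : R.IsLabeling M N (R.branch v) w) (hw : ∀ x ∈ R.branch v, w' x = w x) :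
    R.IsLabeling M N (R.branch v) w' := by
  refine ⟨fun x hx => by rw [hw x hx]; exact h.1 x hx, fun x hx c₁ c₂ hne h₁ h₂ => ?_⟩
  rw [hw x hx, hw c₁ (R.mem_branch_of_isChild hx h₁), hw c₂ (R.mem_branch_of_isChild hx h₂)]
  exact h.2 x hx c₁ c₂ hne h₁ h₂

theorem labelings_finite [Finite V] (M : ℕ) (N : ℕ → ℕ → ℕ → Prop) (v : V) (s : ℕ) :
    (R.labelings M N v s).Finite := by
  refine (Set.Finite.pi' (fun _ : V => Set.finite_le_nat M)).subset fun w hw x => ?_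
  by_cases hx : x ∈ R.branch v
  · exact hw.2.2.1 x hx
  · rw [hw.1 x hx]; exact Nat.zero_le M

theorem ncard_labelings_of_leaf [Finite V] {M : ℕ} {N : ℕ → ℕ → ℕ → Prop} {v : V} {s : ℕ}
    (hs : s ≤ M) (hv : R.depth v ≠ 0) (hleaf : ∀ c, R.depth c ≠ 0 → R.parent c ≠ v) :
    (R.labelings M N v s).ncard = 1 := by
  classical
  have hb : ∀ x, x ∈ R.branch v ↔ x = v := by
    intro x
    rw [R.mem_branch_iff hv]
    exact or_iff_left fun ⟨c, hc, _⟩ => hleaf c hc.1 hc.2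
  rw [Set.ncard_eq_one]
  refine ⟨Pi.single v s, ?_⟩
  ext w
  simp only [labelings, IsLabeling, hb, Set.mem_ofPred_eq, Set.mem_singleton_iff]
  constructor
  · rintro ⟨h1, h2, _⟩
    funext x
    by_cases hx : x = v
    · subst hx; simp [h2]
    · simp [hx, h1 x hx]
  · rintro rfl
    refine ⟨fun x hx => by simp [hx], by simp, fun x hx => by simp [hx, hs], ?_⟩
    rintro x rfl c₁ c₂ _ h₁
    exact absurd h₁.2 (hleaf c₁ h₁.1)

theorem ncard_labelings_of_children [Finite V] {M : ℕ} {N : ℕ → ℕ → ℕ → Prop}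
    (h : FusionRule M N) {v c₁ c₂ : V} {s : ℕ} (hs : s ≤ M) (hv : R.depth v ≠ 0) (hne : c₁ ≠ c₂)
    (h₁ : R.IsChild c₁ v) (h₂ : R.IsChild c₂ v) (hc : ∀ c, R.IsChild c v → c = c₁ ∨ c = c₂) :
    (R.labelings M N v s).ncard =
      fusionConv M N (fun b => (R.labelings M N c₁ b).ncard)
        (fun c => (R.labelings M N c₂ c).ncard) s := by
  classical
  have hb : ∀ x, x ∈ R.branch v ↔ x = v ∨ x ∈ R.branch c₁ ∨ x ∈ R.branch c₂ := by
    intro x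
    rw [R.mem_branch_iff hv]
    constructor
    · rintro (hx | ⟨c, hcv, hx⟩)
      · exact Or.inl hx
      · rcases hc c hcv with rfl | rfl
        · exact Or.inr (Or.inl hx)
        · exact Or.inr (Or.inr hx)
    · rintro (hx | hx | hx)
      · exact Or.inl hx
      · exact Or.inr ⟨c₁, h₁, hx⟩
      · exact Or.inr ⟨c₂, h₂, hx⟩
  have hdisj := Set.disjoint_left.mp (R.disjoint_branch_child hne h₁ h₂)
  have hv₁ := R.not_mem_branch_child h₁
  have hv₂ := R.not_mem_branch_child h₂
  let S : Finset (ℕ × ℕ) := (Finset.range (M + 1) ×ˢ Finset.range (M + 1)).filter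
    fun p => N s p.1 p.2
  let L : V → ℕ → Finset (V → ℕ) := fun v s => (R.labelings_finite M N v s).toFinset
  have hL : ∀ v s w, w ∈ L v s ↔ w ∈ R.labelings M N v s := fun v s w =>
    Set.Finite.mem_toFinset _
  have hcard : ∀ v s, (R.labelings M N v s).ncard = (L v s).card := fun v s =>
    Set.ncard_eq_toFinset_card _ _
  have hmaps : ∀ w ∈ L v s, (w c₁, w c₂) ∈ S := by
    intro w hw
    obtain ⟨_, hws, hlab⟩ := (hL v s w).mp hw
    have hm₁ := hlab.1 c₁ (R.branch_child_subset h₁ (R.self_mem_branch c₁))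
    have hm₂ := hlab.1 c₂ (R.branch_child_subset h₂ (R.self_mem_branch c₂))
    have hN := hlab.2 v (R.self_mem_branch v) c₁ c₂ hne h₁ h₂
    rw [hws] at hN
    exact Finset.mem_filter.mpr ⟨Finset.mem_product.mpr
      ⟨Finset.mem_range.mpr (Nat.lt_succ_of_le hm₁), Finset.mem_range.mpr (Nat.lt_succ_of_le hm₂)⟩,
      hN⟩
  have hfib : ∀ p ∈ S, ((L v s).filter fun w => (w c₁, w c₂) = p).card =
      (L c₁ p.1).card * (L c₂ p.2).card := by
    rintro ⟨b, c⟩ hp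
    obtain ⟨-, hN⟩ := Finset.mem_filter.mp hp
    rw [← Finset.card_product]
    -- Restriction to the two child branches, with inverse given by addition: the branches are
    -- disjoint and labelings vanish outside their own branch.
    refine Finset.card_nbij'
      (fun w => (fun x => if x ∈ R.branch c₁ then w x else 0,
        fun x => if x ∈ R.branch c₂ then w x else 0))
      (fun u x => if x = v then s else u.1 x + u.2 x) ?_ ?_ ?_ ?_
    · intro w hw
      obtain ⟨hw, hbc⟩ := Finset.mem_filter.mp hw
      obtain ⟨h0, hws, hlab⟩ := (hL v s w).mp hw
      simp only [Prod.mk.injEq] at hbc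
      refine Finset.mem_product.mpr ⟨(hL _ _ _).mpr ⟨fun x hx => if_neg hx, ?_, ?_⟩,
        (hL _ _ _).mpr ⟨fun x hx => if_neg hx, ?_, ?_⟩⟩
      · simp [R.self_mem_branch, hbc.1]
      · refine IsLabeling.congr (w := w) ⟨fun x hx => hlab.1 x (R.branch_child_subset h₁ hx),
          fun x hx => hlab.2 x (R.branch_child_subset h₁ hx)⟩ fun x hx => by simp [hx]
      · simp [R.self_mem_branch, hbc.2]
      · refine IsLabeling.congr (w := w) ⟨fun x hx => hlab.1 x (R.branch_child_subset h₂ hx),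
          fun x hx => hlab.2 x (R.branch_child_subset h₂ hx)⟩ fun x hx => by simp [hx]
    · rintro ⟨w₁, w₂⟩ hu
      obtain ⟨hu₁, hu₂⟩ := Finset.mem_product.mp hu
      obtain ⟨hz₁, hs₁, hl₁⟩ := (hL _ _ _).mp hu₁
      obtain ⟨hz₂, hs₂, hl₂⟩ := (hL _ _ _).mp hu₂
      simp only at hz₁ hs₁ hl₁ hz₂ hs₂ hl₂
      have e₁ : ∀ x ∈ R.branch c₁, (if x = v then s else w₁ x + w₂ x) = w₁ x := by
        intro x hx
        rw [if_neg (fun hxv : x = v => hv₁ (hxv ▸ hx)), hz₂ x (hdisj hx), add_zero]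
      have e₂ : ∀ x ∈ R.branch c₂, (if x = v then s else w₁ x + w₂ x) = w₂ x := by
        intro x hx
        rw [if_neg (fun hxv : x = v => hv₂ (hxv ▸ hx)), hz₁ x (fun hx' => hdisj hx' hx), zero_add]
      have hl₁' := hl₁.congr e₁
      have hl₂' := hl₂.congr e₂
      refine Finset.mem_filter.mpr ⟨(hL _ _ _).mpr ⟨fun x hx => ?_, if_pos rfl, ?_, ?_⟩, ?_⟩
      · rw [hb] at hx
        push Not at hx
        simp [hx.1, hz₁ x hx.2.1, hz₂ x hx.2.2]
      · intro x hx
        rcases (hb x).mp hx with rfl | hx | hx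
        · simpa using hs
        · exact hl₁'.1 x hx
        · exact hl₂'.1 x hx
      · intro x hx d₁ d₂ hd hd₁ hd₂
        rcases (hb x).mp hx with rfl | hx | hx
        · have hN' : N s (w₁ c₁) (w₂ c₂) := by rw [hs₁, hs₂]; exact hN
          rcases hc d₁ hd₁ with rfl | rfl <;> rcases hc d₂ hd₂ with rfl | rfl
          · exact absurd rfl hd
          · simp only [e₁ _ (R.self_mem_branch _), e₂ _ (R.self_mem_branch _), if_true]
            exact hN'
          · simp only [e₁ _ (R.self_mem_branch _), e₂ _ (R.self_mem_branch _), if_true]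
            exact h.swap_right hN'
          · exact absurd rfl hd
        · exact hl₁'.2 x hx d₁ d₂ hd hd₁ hd₂
        · exact hl₂'.2 x hx d₁ d₂ hd hd₁ hd₂
      · exact Prod.ext ((e₁ _ (R.self_mem_branch _)).trans hs₁)
          ((e₂ _ (R.self_mem_branch _)).trans hs₂)
    · intro w hw
      obtain ⟨h0, hws, hlab⟩ := (hL v s w).mp (Finset.mem_filter.mp hw).1
      funext x
      by_cases hxv : x = v
      · simp [hxv, hws]
      · by_cases hx₁ : x ∈ R.branch c₁
        · simp [hxv, hx₁, hdisj hx₁]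
        · by_cases hx₂ : x ∈ R.branch c₂
          · simp [hxv, hx₁, hx₂]
          · have : x ∉ R.branch v := by rw [hb]; tauto
            simp [hxv, hx₁, hx₂, h0 x this]
    · rintro ⟨w₁, w₂⟩ hu
      obtain ⟨hu₁, hu₂⟩ := Finset.mem_product.mp hu
      obtain ⟨hz₁, -, -⟩ := (hL _ _ _).mp hu₁
      obtain ⟨hz₂, -, -⟩ := (hL _ _ _).mp hu₂
      simp only at hz₁ hz₂
      simp only [Prod.mk.injEq]
      constructor
      · funext x
        by_cases hx : x ∈ R.branch c₁
        · have : x ≠ v := fun hxv => hv₁ (hxv ▸ hx)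
          simp [hx, this, hz₂ x (hdisj hx)]
        · simp [hx, hz₁ x hx]
      · funext x
        by_cases hx : x ∈ R.branch c₂
        · have : x ≠ v := fun hxv => hv₂ (hxv ▸ hx)
          simp [hx, this, hz₁ x (fun hx' => hdisj hx' hx)]
        · simp [hx, hz₂ x hx]
  rw [hcard, Finset.card_eq_sum_card_fiberwise hmaps, Finset.sum_congr rfl hfib,
    Finset.sum_filter, Finset.sum_product, fusionConv]
  simp only [hcard]

theorem fusionConv_congr {M : ℕ} {N : ℕ → ℕ → ℕ → Prop} {f f' g g' : ℕ → ℕ}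
    (hf : ∀ b ≤ M, f b = f' b) (hg : ∀ b ≤ M, g b = g' b) (s : ℕ) :
    fusionConv M N f g s = fusionConv M N f' g' s := by
  unfold fusionConv
  refine Finset.sum_congr rfl fun b hb => Finset.sum_congr rfl fun c hc => ?_
  rw [hf b (Nat.lt_succ_iff.mp (Finset.mem_range.mp hb)),
    hg c (Nat.lt_succ_iff.mp (Finset.mem_range.mp hc))]

/-- Associativity erases the shape of the branch: k + 1 is its number of leaves, which adds up over
the two children. Since k precedes M and N, one exponent serves all levels t and both rules. -/
theorem exists_ncard_labelings_eq_fusionPow [Finite V] (v : V) (hv : R.depth v ≠ 0) :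
    ∃ k, ∀ (M : ℕ) (N : ℕ → ℕ → ℕ → Prop), FusionRule M N → ∀ s ≤ M,
      (R.labelings M N v s).ncard = fusionPow M N k s := by
  obtain ⟨B, hB⟩ := (Set.finite_range R.depth).bddAbove
  have hB' : ∀ v, R.depth v ≤ B := fun v => hB ⟨v, rfl⟩
  obtain ⟨n, hn⟩ : ∃ n, n = B - R.depth v := ⟨_, rfl⟩
  induction n using Nat.strong_induction_on generalizing v with
  | _ n ih =>
    rcases R.children v hv with hleaf | ⟨c₁, c₂, hne, h₁, h₂, hc⟩
    · exact ⟨0, fun M N _ s hs => R.ncard_labelings_of_leaf hs hv hleaf⟩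
    · have hd₁ := R.depth_child h₁
      have hd₂ := R.depth_child h₂
      have hb₁ := hB' c₁
      have hb₂ := hB' c₂
      obtain ⟨k₁, hk₁⟩ := ih (B - R.depth c₁) (by omega) c₁ h₁.1 rfl
      obtain ⟨k₂, hk₂⟩ := ih (B - R.depth c₂) (by omega) c₂ h₂.1 rfl
      refine ⟨k₁ + k₂ + 1, fun M N h s hs => ?_⟩
      rw [R.ncard_labelings_of_children h hs hv hne h₁ h₂ fun c hcv => hc c hcv.1 hcv.2,
        fusionConv_congr (hk₁ M N h) (hk₂ M N h), h.conv_pow_pow]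

end RootedBinary

/-! ### Edge labelings of trees -/

namespace SimpleGraph

/-- Any such u is the penultimate node of a path from r to v, and a tree has only one such path. -/
theorem IsTree.existsUnique_adj_dist_succ {V : Type*} {T : SimpleGraph V} (hT : T.IsTree) {r v : V}
    (hv : v ≠ r) : ∃! u, T.Adj v u ∧ T.dist r u + 1 = T.dist r v := by
  have hpos := hT.connected.pos_dist_of_ne hv.symm
  have key : ∀ u, T.Adj v u → T.dist r u + 1 = T.dist r v →
      ∃ p : T.Walk r v, p.IsPath ∧ p.penultimate = u := by
    intro u hadj hu
    obtain ⟨q, hq, hql⟩ := hT.connected.exists_path_of_dist r u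
    have hvq : v ∉ q.support := by
      intro hmem
      classical
      have h1 := (T.dist_le (q.takeUntil v hmem)).trans (q.length_takeUntil_le_length hmem)
      omega
    exact ⟨q.concat hadj.symm, hq.concat hvq hadj.symm, Walk.penultimate_concat q hadj.symm⟩
  obtain ⟨p, hp, hpl⟩ := hT.connected.exists_path_of_dist r v
  have hnil : ¬ p.Nil := by
    intro h
    have := Walk.length_eq_zero_iff.mpr h
    omega
  have hadj : T.Adj p.penultimate v := p.adj_penultimate hnil
  refine ⟨p.penultimate, ⟨hadj.symm, ?_⟩, ?_⟩
  · have h1 := T.dist_le p.dropLast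
    have h2 : p.dropLast.length + 1 = p.length := Walk.length_dropLast_add_one hnil
    have h3 := hT.dist_eq_dist_add_one_of_adj r hadj
    omega
  · rintro u ⟨hu, hd⟩
    obtain ⟨q, hq, rfl⟩ := key u hu hd
    have := (hT.isAcyclic.subsingleton_path r v).elim ⟨q, hq⟩ ⟨p, hp⟩
    rw [Subtype.mk.injEq] at this
    rw [this]

/-- The edges of a rooted tree correspond to the nodes other than the root. -/
theorem exists_equiv_edgeSet {V : Type*} {G : SimpleGraph V} {R : RootedBinary V}
    (hR : ∀ u v, G.Adj u v ↔ R.IsChild u v ∨ R.IsChild v u) :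
    ∃ φ : {v // R.depth v ≠ 0} ≃ G.edgeSet, ∀ v, (φ v : Sym2 V) = s(v.1, R.parent v) := by
  have hadj : ∀ v : {v // R.depth v ≠ 0}, G.Adj v (R.parent v) := fun v =>
    (hR _ _).mpr (Or.inl ⟨v.2, rfl⟩)
  let f : {v // R.depth v ≠ 0} → G.edgeSet := fun v => ⟨s(v.1, R.parent v), hadj v⟩
  refine ⟨Equiv.ofBijective f ⟨?_, ?_⟩, fun v => rfl⟩
  · intro u v huv
    have h := congrArg Subtype.val huv
    simp only [f, Sym2.eq_iff] at h
    rcases h with ⟨h, -⟩ | ⟨h1, h2⟩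
    · exact Subtype.ext h
    · have h3 := R.depth_child (c := u.1) ⟨u.2, rfl⟩
      have h4 := R.depth_child (c := v.1) ⟨v.2, rfl⟩
      rw [h2] at h3
      rw [← h1] at h4
      omega
  · rintro ⟨e, he⟩
    induction e using Sym2.ind with
    | _ u v =>
      rcases (hR u v).mp he with h | h
      · exact ⟨⟨u, h.1⟩, Subtype.ext (by simp [f, h.2])⟩
      · exact ⟨⟨v, h.1⟩, Subtype.ext (by simp [f, h.2, Sym2.eq_swap])⟩

variable {V : Type*} [Fintype V] (G : SimpleGraph V) [DecidableRel G.Adj]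

/-- Edge labels at most `M` with the relation `N` between the labels at every internal node. -/
def IsEdgeLabeling (M : ℕ) (N : ℕ → ℕ → ℕ → Prop) (w : G.edgeSet → ℕ) : Prop :=
  (∀ e, w e ≤ M) ∧ ∀ (v : G.InternalNode) (a b c : G.edgeSet), G.EdgesAt v a b c →
    N (w a) (w b) (w c)

variable {G}

theorem IsTree.exists_rootedBinary (hT : G.IsTree) (h13 : G.IsOneThreeGraph) (r : V) :
    ∃ R : RootedBinary V, (∀ v, R.depth v = G.dist r v) ∧
      ∀ u v, G.Adj u v ↔ R.IsChild u v ∨ R.IsChild v u := by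
  classical
  choose! par hpar using fun v (hv : v ≠ r) => (hT.existsUnique_adj_dist_succ (r := r) hv).exists
  have huniq : ∀ v ≠ r, ∀ u, G.Adj v u → G.dist r u + 1 = G.dist r v → u = par v :=
    fun v hv u h1 h2 => (hT.existsUnique_adj_dist_succ hv).unique ⟨h1, h2⟩ (hpar v hv)
  have hzero : ∀ v, G.dist r v ≠ 0 ↔ v ≠ r := fun v => by
    rw [ne_eq, hT.connected.dist_eq_zero_iff, eq_comm]
  let parent : V → V := fun v => if v = r then r else par v
  have hparent : ∀ v ≠ r, parent v = par v := fun v hv => if_neg hv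
  have hchild : ∀ u v, (u ≠ r ∧ parent u = v) ↔ G.Adj v u ∧ G.dist r u = G.dist r v + 1 := by
    intro u v
    constructor
    · rintro ⟨hu, rfl⟩
      rw [hparent u hu]
      exact ⟨(hpar u hu).1.symm, (hpar u hu).2.symm⟩
    · rintro ⟨hadj, hd⟩
      have hu : u ≠ r := by rw [← hzero]; omega
      exact ⟨hu, by rw [hparent u hu, huniq u hu v hadj.symm hd.symm]⟩
  refine ⟨⟨parent, G.dist r, ?_, ?_⟩, fun v => rfl, ?_⟩
  · intro v
    by_cases hv : v = r
    · simp [parent, hv]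
    · rw [hparent v hv, ← (hpar v hv).2, Nat.add_sub_cancel]
  · intro v hv
    rw [hzero] at hv
    have hmem : par v ∈ G.neighborFinset v := by
      rw [mem_neighborFinset]; exact (hpar v hv).1
    have hch : ∀ c, c ∈ (G.neighborFinset v).erase (par v) ↔ c ≠ r ∧ parent c = v := by
      intro c
      rw [hchild, Finset.mem_erase, mem_neighborFinset]
      constructor
      · rintro ⟨hne, hadj⟩
        refine ⟨hadj, ?_⟩
        rcases hT.dist_eq_dist_add_one_of_adj r hadj with h | h
        · exact absurd (huniq v hv c hadj h.symm) hne
        · exact h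
      · rintro ⟨hadj, hd⟩
        refine ⟨?_, hadj⟩
        rintro rfl
        have := (hpar v hv).2
        omega
    have hcard : ((G.neighborFinset v).erase (par v)).card = G.degree v - 1 := by
      rw [Finset.card_erase_of_mem hmem, card_neighborFinset_eq_degree]
    simp only [hzero]
    rcases h13 v with h1 | h3
    · left
      rw [h1, Nat.sub_self, Finset.card_eq_zero] at hcard
      intro c hc hcv
      have := (hch c).mpr ⟨hc, hcv⟩
      rw [hcard] at this
      exact Finset.notMem_empty c this
    · right
      rw [h3] at hcard
      obtain ⟨c₁, c₂, hne, heq⟩ := Finset.card_eq_two.mp hcard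
      rw [heq] at hch
      refine ⟨c₁, c₂, hne, (hch c₁).mp (by simp), (hch c₂).mp (by simp), fun c hc hcv => ?_⟩
      simpa using (hch c).mpr ⟨hc, hcv⟩
  · intro u v
    simp only [RootedBinary.IsChild, hzero, hchild]
    constructor
    · intro hadj
      rcases hT.dist_eq_dist_add_one_of_adj r hadj with h | h
      · exact Or.inl ⟨hadj.symm, h⟩
      · exact Or.inr ⟨hadj, h⟩
    · rintro (h | h)
      · exact h.1.symm
      · exact h.1

/-- Root at a leaf r with neighbour c₀. Moving each edge label to the lower end of the edge gives
labelings of the branch at c₀, which contains every node except r. The label of c₀ is free, and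
summing over it raises the power by one through `sum_pow`. -/
theorem IsTree.exists_ncard_edgeLabelings (hT : G.IsTree) (h13 : G.IsOneThreeGraph) :
    ∃ k, ∀ (M : ℕ) (N : ℕ → ℕ → ℕ → Prop), FusionRule M N →
      {w | G.IsEdgeLabeling M N w}.ncard = fusionPow M N (k + 1) 0 := by
  classical
  obtain ⟨v₀⟩ := hT.connected.nonempty
  have : Nontrivial V := by
    have hd : 0 < G.degree v₀ := by rcases h13 v₀ with h | h <;> omega
    obtain ⟨u, hu⟩ := (G.degree_pos_iff_exists_adj v₀).mp hd
    exact ⟨⟨v₀, u, hu.ne⟩⟩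
  obtain ⟨r, hr⟩ := hT.exists_vert_degree_one_of_nontrivial
  obtain ⟨R, hdep, hR⟩ := hT.exists_rootedBinary h13 r
  obtain ⟨φ, hφ⟩ := exists_equiv_edgeSet hR
  obtain ⟨c₀, hc₀, hc₀u⟩ := degree_eq_one_iff_existsUnique_adj.mp hr
  have hzero : ∀ v, R.depth v = 0 ↔ v = r := fun v => by
    rw [hdep, hT.connected.dist_eq_zero_iff, eq_comm]
  have hc₀d : R.depth c₀ ≠ 0 := fun h => hc₀.ne ((hzero c₀).mp h).symm
  have hbranch : ∀ x, x ∈ R.branch c₀ ↔ R.depth x ≠ 0 := by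
    intro x
    constructor
    · intro hx
      have := R.depth_le_of_mem_branch hx
      omega
    · intro hx
      refine ⟨R.depth x - 1, hc₀u _ ?_⟩
      have h1 : R.depth (R.parent^[R.depth x - 1] x) = 1 := by rw [R.depth_iterate]; omega
      have h2 : R.parent (R.parent^[R.depth x - 1] x) = r := by
        rw [← hzero, R.depth_parent, h1]
      exact (hR _ _).mpr (Or.inr ⟨by omega, h2⟩)
  have hmem : ∀ (v : V) (u : {v // R.depth v ≠ 0}),
      v ∈ (φ u : Sym2 V) ↔ v = u.1 ∨ R.IsChild u v := by
    intro v u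
    rw [hφ, Sym2.mem_iff, RootedBinary.IsChild, and_iff_right u.2, eq_comm (a := v)
      (b := R.parent u)]
  obtain ⟨k, hk⟩ := R.exists_ncard_labelings_eq_fusionPow c₀ hc₀d
  refine ⟨k, fun M N h => ?_⟩
  let F : (G.edgeSet → ℕ) → V → ℕ := fun w x => if hx : R.depth x ≠ 0 then w (φ ⟨x, hx⟩) else 0
  have hF : ∀ w x (hx : R.depth x ≠ 0), F w x = w (φ ⟨x, hx⟩) := fun w x hx => dif_pos hx
  have hFinj : Function.Injective F := by
    intro w w' hww
    funext e
    obtain ⟨u, rfl⟩ := φ.surjective e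
    have := congrFun hww u.1
    rwa [hF w u.1 u.2, hF w' u.1 u.2] at this
  have himage : F '' {w | G.IsEdgeLabeling M N w} =
      {w | (∀ x ∉ R.branch c₀, w x = 0) ∧ R.IsLabeling M N (R.branch c₀) w} := by
    ext w
    constructor
    · rintro ⟨w, ⟨hw1, hw2⟩, rfl⟩
      refine ⟨fun x hx => ?_, fun x hx => ?_, fun x hx c₁ c₂ hne h₁ h₂ => ?_⟩
      · rw [hbranch] at hx
        exact dif_neg hx
      · rw [hF w x ((hbranch x).mp hx)]
        exact hw1 _
      · have hx' := (hbranch x).mp hx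
        rw [hF w x hx', hF w c₁ h₁.1, hF w c₂ h₂.1]
        have hdeg : G.degree x = 3 := by
          refine (h13 x).resolve_left fun h1 => hne ?_
          exact (degree_eq_one_iff_existsUnique_adj.mp h1).unique
            ((hR _ _).mpr (Or.inr h₁)) ((hR _ _).mpr (Or.inr h₂))
        have hd₁ := R.depth_child h₁
        have hd₂ := R.depth_child h₂
        refine hw2 ⟨x, hdeg⟩ _ _ _ ⟨?_, ?_, ?_, ?_, ?_, ?_⟩
        · rw [ne_eq, φ.apply_eq_iff_eq, Subtype.mk.injEq]; rintro rfl; omega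
        · rw [ne_eq, φ.apply_eq_iff_eq, Subtype.mk.injEq]; rintro rfl; omega
        · rw [ne_eq, φ.apply_eq_iff_eq, Subtype.mk.injEq]; exact hne
        · exact (hmem _ _).mpr (Or.inl rfl)
        · exact (hmem _ _).mpr (Or.inr h₁)
        · exact (hmem _ _).mpr (Or.inr h₂)
    · rintro ⟨hw0, hw1, hw2⟩
      refine ⟨fun e => w (φ.symm e), ⟨fun e => hw1 _ ((hbranch _).mpr (φ.symm e).2), ?_⟩, ?_⟩
      · rintro ⟨v, hv⟩ a b c ⟨hab, hac, hbc, hva, hvb, hvc⟩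
        obtain ⟨α, rfl⟩ := φ.surjective a
        obtain ⟨β, rfl⟩ := φ.surjective b
        obtain ⟨γ, rfl⟩ := φ.surjective c
        simp only [Equiv.symm_apply_apply]
        rw [ne_eq, φ.apply_eq_iff_eq, Subtype.ext_iff] at hab hac hbc
        have hvr : R.depth v ≠ 0 := by
          rw [ne_eq, hzero]
          rintro rfl
          omega
        have hN := hw2 v ((hbranch v).mpr hvr)
        -- Exactly one of the three edges leads to the parent; the symmetry of N brings its label to
        -- the front. Three child edges are impossible, as a node has at most two children.
        rcases (hmem _ _).mp hva with ha | ha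
        · have hb := ((hmem _ _).mp hvb).resolve_left fun hb => hab (ha.symm.trans hb)
          have hc := ((hmem _ _).mp hvc).resolve_left fun hc => hac (ha.symm.trans hc)
          rw [← ha]
          exact hN _ _ hbc hb hc
        · rcases (hmem _ _).mp hvb with hb | hb
          · have hc := ((hmem _ _).mp hvc).resolve_left fun hc => hbc (hb.symm.trans hc)
            rw [← hb]
            exact h.swap_left (hN _ _ hac ha hc)
          · rcases (hmem _ _).mp hvc with hc | hc
            · rw [← hc]
              exact h.swap_right (h.swap_left (hN _ _ hab ha hb))
            · exfalso
              rcases R.children v hvr with hleaf | ⟨c₁, c₂, -, -, -, hcc⟩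
              · exact hleaf _ ha.1 ha.2
              · have h1 := hcc _ ha.1 ha.2
                have h2 := hcc _ hb.1 hb.2
                have h3 := hcc _ hc.1 hc.2
                grind
      · funext x
        by_cases hx : R.depth x ≠ 0
        · refine (hF (fun e => w (φ.symm e)) x hx).trans ?_
          simp only [Equiv.symm_apply_apply]
        · rw [hw0 x (by rw [hbranch]; exact hx)]
          exact dif_neg hx
  rw [← Set.ncard_image_of_injective _ hFinj, himage, ← h.sum_pow]
  let L : ℕ → Finset (V → ℕ) := fun s => (R.labelings_finite M N c₀ s).toFinset
  have hset : {w | (∀ x ∉ R.branch c₀, w x = 0) ∧ R.IsLabeling M N (R.branch c₀) w} =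
      ((Finset.range (M + 1)).biUnion L : Finset (V → ℕ)) := by
    ext w
    simp only [L, Finset.coe_biUnion, Set.mem_iUnion, Set.Finite.coe_toFinset, Finset.coe_range,
      exists_prop, Set.mem_Iio]
    constructor
    · rintro ⟨h1, h2⟩
      exact ⟨w c₀, Nat.lt_succ_of_le (h2.1 _ (R.self_mem_branch _)), h1, rfl, h2⟩
    · rintro ⟨s, -, h1, -, h2⟩
      exact ⟨h1, h2⟩
  rw [hset, Set.ncard_coe_finset, Finset.card_biUnion]
  · refine Finset.sum_congr rfl fun s hs => ?_
    rw [← hk M N h s (Nat.lt_succ_iff.mp (Finset.mem_range.mp hs)),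
      Set.ncard_eq_toFinset_card _ (R.labelings_finite M N c₀ s)]
  · intro s _ s' _ hss
    refine Finset.disjoint_left.mpr fun w hw hw' => ?_
    rw [Set.Finite.mem_toFinset] at hw hw'
    exact hss (hw.2.1.symm.trans hw'.2.1)

end SimpleGraph

/-! ### Lattice points of the dilated polytopes -/

namespace SimpleGraph

theorem EdgesAt.swap_left {V : Type*} {G : SimpleGraph V} {v : V}
    {a b c : G.edgeSet} (h : G.EdgesAt v a b c) : G.EdgesAt v b a c :=
  ⟨h.1.symm, h.2.2.1, h.2.1, h.2.2.2.2.1, h.2.2.2.1, h.2.2.2.2.2⟩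

theorem EdgesAt.swap_right {V : Type*} {G : SimpleGraph V} {v : V}
    {a b c : G.edgeSet} (h : G.EdgesAt v a b c) : G.EdgesAt v a c b :=
  ⟨h.2.1, h.1, h.2.2.1.symm, h.2.2.2.1, h.2.2.2.2.2, h.2.2.2.2.1⟩

variable {V : Type*} [Fintype V] {G : SimpleGraph V} [DecidableRel G.Adj]

open Classical in
/-- The edges at a node. -/
noncomputable def edgesAtFinset (G : SimpleGraph V) [DecidableRel G.Adj] (v : V) :
    Finset G.edgeSet :=
  Finset.univ.filter fun e => v ∈ (e : Sym2 V)

theorem mem_edgesAtFinset {v : V} {e : G.edgeSet} :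
    e ∈ G.edgesAtFinset v ↔ v ∈ (e : Sym2 V) := by
  simp [edgesAtFinset]

theorem card_edgesAtFinset (v : V) : (G.edgesAtFinset v).card = G.degree v := by
  classical
  rw [← card_incidenceFinset_eq_degree, ← Finset.card_map (Function.Embedding.subtype _)]
  congr 1
  ext e
  simp [mem_edgesAtFinset, incidenceSet, and_comm]

theorem EdgesAt.finset_eq {v : V} (hv : G.degree v = 3) {a b c : G.edgeSet}
    (h : G.EdgesAt v a b c) [DecidableEq G.edgeSet] : G.edgesAtFinset v = {a, b, c} := by
  obtain ⟨hab, hac, hbc, ha, hb, hc⟩ := h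
  symm
  refine Finset.eq_of_subset_of_card_le ?_ ?_
  · intro e he
    simp only [Finset.mem_insert, Finset.mem_singleton] at he
    rw [mem_edgesAtFinset]
    rcases he with rfl | rfl | rfl <;> assumption
  · rw [card_edgesAtFinset, hv, Finset.card_eq_three.mpr ⟨a, b, c, hab, hac, hbc, rfl⟩]

theorem EdgesAt.sum_eq {v : V} (hv : G.degree v = 3) {a b c : G.edgeSet}
    (h : G.EdgesAt v a b c) (x : G.edgeSet → ℝ) :
    ∑ e ∈ G.edgesAtFinset v, x e = x a + x b + x c := by
  classical
  rw [h.finset_eq hv, Finset.sum_insert (by simp [h.1, h.2.1]),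
    Finset.sum_insert (by simp [h.2.2.1]), Finset.sum_singleton, add_assoc]

theorem exists_edgesAt {v : V} (hv : G.degree v = 3) : ∃ a b c, G.EdgesAt v a b c := by
  classical
  have h := card_edgesAtFinset (G := G) v
  rw [hv] at h
  obtain ⟨a, b, c, hab, hac, hbc, heq⟩ := Finset.card_eq_three.mp h
  refine ⟨a, b, c, hab, hac, hbc, ?_, ?_, ?_⟩ <;>
  · rw [← mem_edgesAtFinset, heq]; simp

theorem IsOneThreeGraph.isComponentEdge_or (h13 : G.IsOneThreeGraph) (e : G.edgeSet) :
    G.IsComponentEdge e ∨ ∃ (v : G.InternalNode) (b c : G.edgeSet), G.EdgesAt v e b c := by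
  classical
  refine or_iff_not_imp_left.mpr fun hcomp => ?_
  unfold IsComponentEdge at hcomp
  push Not at hcomp
  obtain ⟨v, hve, f, hvf, hfe⟩ := hcomp
  have hsub : ({e, f} : Finset G.edgeSet) ⊆ G.edgesAtFinset v := by
    intro g hg
    simp only [Finset.mem_insert, Finset.mem_singleton] at hg
    rw [mem_edgesAtFinset]
    rcases hg with rfl | rfl <;> assumption
  have hcard : ({e, f} : Finset G.edgeSet).card = 2 := Finset.card_pair hfe.symm
  have hle := Finset.card_le_card hsub
  rw [card_edgesAtFinset, hcard] at hle
  have hv : G.degree v = 3 := (h13 v).resolve_left (by omega)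
  obtain ⟨g, hg, hgn⟩ := Finset.exists_mem_notMem_of_card_lt_card
    (s := ({e, f} : Finset G.edgeSet)) (t := G.edgesAtFinset v)
    (by rw [card_edgesAtFinset, hcard, hv]; norm_num)
  simp only [Finset.mem_insert, Finset.mem_singleton, not_or] at hgn
  exact ⟨⟨v, hv⟩, f, g, hfe.symm, fun h => hgn.1 h.symm, fun h => hgn.2 h.symm, hve, hvf,
    mem_edgesAtFinset.mp hg⟩

/-- At an internal node, adding two triangle inequalities gives nonnegativity, and twice a label is
at most the perimeter. Edges meeting no internal node are covered by `h2`. -/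
theorem IsOneThreeGraph.bounds (h13 : G.IsOneThreeGraph) {t : ℝ} {x : G.edgeSet → ℝ}
    (h1 : ∀ (v : G.InternalNode) (a b c : G.edgeSet), G.EdgesAt v a b c →
      x a ≤ x b + x c ∧ x a + x b + x c ≤ 2 * t)
    (h2 : ∀ e, G.IsComponentEdge e → 0 ≤ x e ∧ x e ≤ t) (e : G.edgeSet) : 0 ≤ x e ∧ x e ≤ t := by
  rcases h13.isComponentEdge_or e with he | ⟨v, b, c, he⟩
  · exact h2 e he
  · have ha := h1 v _ _ _ he
    have hb := h1 v _ _ _ he.swap_left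
    have hc := h1 v _ _ _ he.swap_right.swap_left
    constructor <;> linarith

theorem IsOneThreeGraph.mem_smul_polytopeP (h13 : G.IsOneThreeGraph) (t : ℕ)
    (x : G.edgeSet → ℝ) : x ∈ (t : ℝ) • G.polytopeP ↔
      (∀ (v : G.InternalNode) (a b c : G.edgeSet), G.EdgesAt v a b c →
        x a ≤ x b + x c ∧ x a + x b + x c ≤ t) ∧
      ∀ e, G.IsComponentEdge e → 0 ≤ x e ∧ x e ≤ t / 2 := by
  have ht : (0 : ℝ) ≤ t := t.cast_nonneg
  constructor
  · rintro ⟨y, ⟨h1, h2⟩, rfl⟩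
    simp only [Pi.smul_apply, smul_eq_mul]
    refine ⟨fun v a b c habc => ?_, fun e he => ?_⟩
    · obtain ⟨h3, h4⟩ := h1 v a b c habc
      have h5 := mul_le_mul_of_nonneg_left h3 ht
      have h6 := mul_le_mul_of_nonneg_left h4 ht
      constructor <;> linarith
    · obtain ⟨h3, h4⟩ := h2 e he
      have h5 := mul_nonneg ht h3
      have h6 := mul_le_mul_of_nonneg_left h4 ht
      constructor <;> linarith
  · rintro ⟨h1, h2⟩
    -- For t = 0 one cannot divide by t; there the inequalities leave only x = 0, which is 0 times
    -- the point 0 of the polytope.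
    rcases ht.eq_or_lt with h0 | hpos
    · have hx : x = 0 := by
        funext e
        have := h13.bounds (t := (t : ℝ) / 2) (x := x)
          (fun v a b c habc => by have := h1 v a b c habc; constructor <;> linarith) h2 e
        exact le_antisymm (by simpa [← h0] using this.2) this.1
      exact ⟨0, ⟨fun _ _ _ _ _ => by norm_num, fun _ _ => by norm_num⟩, by simp [hx]⟩
    · rw [Set.mem_smul_set_iff_inv_smul_mem₀ hpos.ne']
      have hi : (0 : ℝ) ≤ (t : ℝ)⁻¹ := inv_nonneg.mpr ht
      have hm : (t : ℝ)⁻¹ * t = 1 := inv_mul_cancel₀ hpos.ne'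
      refine ⟨fun v a b c habc => ?_, fun e he => ?_⟩ <;> simp only [Pi.smul_apply, smul_eq_mul]
      · obtain ⟨h3, h4⟩ := h1 v a b c habc
        have h5 := mul_le_mul_of_nonneg_left h3 hi
        have h6 := mul_le_mul_of_nonneg_left h4 hi
        constructor <;> linarith
      · obtain ⟨h3, h4⟩ := h2 e he
        have h5 := mul_nonneg hi h3
        have h6 := mul_le_mul_of_nonneg_left h4 hi
        constructor <;> linarith

theorem IsOneThreeGraph.mem_smul_polytopeQ (h13 : G.IsOneThreeGraph) (t : ℕ)
    (x : G.edgeSet → ℝ) (z : G.InternalNode → ℝ) : (x, z) ∈ (t : ℝ) • G.polytopeQ ↔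
      (∀ (v : G.InternalNode) (a b c : G.edgeSet), G.EdgesAt v a b c →
        x a ≤ x b + x c ∧ x a + x b + x c = 2 * z v ∧ z v ≤ t) ∧
      ∀ e, G.IsComponentEdge e → 0 ≤ x e ∧ x e ≤ t := by
  have ht : (0 : ℝ) ≤ t := t.cast_nonneg
  constructor
  · rintro ⟨⟨y, u⟩, ⟨h1, h2⟩, heq⟩
    obtain ⟨rfl, rfl⟩ := Prod.ext_iff.mp heq
    simp only [Prod.smul_mk, Pi.smul_apply, smul_eq_mul]
    refine ⟨fun v a b c habc => ?_, fun e he => ?_⟩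
    · obtain ⟨h3, h4, h7⟩ := h1 v a b c habc
      have h5 := mul_le_mul_of_nonneg_left h3 ht
      have h6 := mul_le_mul_of_nonneg_left h7 ht
      have h8 := congrArg (fun r => (t : ℝ) * r) h4
      simp only at h5 h6 h8
      refine ⟨by linarith, by linarith, by linarith⟩
    · obtain ⟨h3, h4⟩ := h2 e he
      have h5 := mul_nonneg ht h3
      have h6 := mul_le_mul_of_nonneg_left h4 ht
      simp only at h5 h6
      constructor <;> linarith
  · rintro ⟨h1, h2⟩
    rcases ht.eq_or_lt with h0 | hpos
    · have hx : x = 0 := by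
        funext e
        have := h13.bounds (t := (t : ℝ)) (x := x)
          (fun v a b c habc => by have := h1 v a b c habc; constructor <;> linarith) h2 e
        exact le_antisymm (by simpa [← h0] using this.2) this.1
      have hz : z = 0 := by
        funext v
        obtain ⟨a, b, c, habc⟩ := exists_edgesAt v.2
        have := (h1 v a b c habc).2.1
        simp only [hx, Pi.zero_apply] at this
        simp only [Pi.zero_apply]
        linarith
      exact ⟨0, ⟨fun _ _ _ _ _ => by simp, fun _ _ => by simp⟩, by simp [hx, hz]; rfl⟩
    · rw [Set.mem_smul_set_iff_inv_smul_mem₀ hpos.ne']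
      have hi : (0 : ℝ) ≤ (t : ℝ)⁻¹ := inv_nonneg.mpr ht
      have hm : (t : ℝ)⁻¹ * t = 1 := inv_mul_cancel₀ hpos.ne'
      refine ⟨fun v a b c habc => ?_, fun e he => ?_⟩ <;>
        simp only [Prod.smul_mk, Pi.smul_apply, smul_eq_mul]
      · obtain ⟨h3, h4, h7⟩ := h1 v a b c habc
        have h5 := mul_le_mul_of_nonneg_left h3 hi
        have h6 := mul_le_mul_of_nonneg_left h7 hi
        have h8 := congrArg (fun r => (t : ℝ)⁻¹ * r) h4
        beta_reduce at h8
        refine ⟨by linarith, by linarith, by linarith⟩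
      · obtain ⟨h3, h4⟩ := h2 e he
        have h5 := mul_nonneg hi h3
        have h6 := mul_le_mul_of_nonneg_left h4 hi
        constructor <;> linarith

theorem natCast_comp_injective (ι : Type*) :
    Function.Injective (fun (w : ι → ℕ) (i : ι) => (w i : ℝ)) := by
  intro w w' h
  funext i
  have := congrFun h i
  beta_reduce at this
  exact_mod_cast this

theorem exists_natCast_eq {ι : Type*} {x : ι → ℝ} (hx : x ∈ integerPoints ι) (h0 : ∀ i, 0 ≤ x i) :
    ∃ w : ι → ℕ, (fun i => (w i : ℝ)) = x := by
  choose n hn using hx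
  refine ⟨fun i => (n i).toNat, funext fun i => ?_⟩
  have h : 0 ≤ n i := by
    have := h0 i
    rw [hn i] at this
    exact_mod_cast this
  rw [hn i]
  exact_mod_cast Int.toNat_of_nonneg h

theorem IsOneThreeGraph.ehrhartP_eq (h13 : G.IsOneThreeGraph) (t : ℕ) :
    G.ehrhartP t = {w | G.IsEdgeLabeling (t / 2) (TriangleRule t) w}.ncard := by
  rw [← Set.ncard_image_of_injective _ (natCast_comp_injective G.edgeSet), ehrhartP,
    ehrhartFunction]
  congr 1
  ext x
  rw [Set.mem_inter_iff, h13.mem_smul_polytopeP]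
  constructor
  · rintro ⟨⟨h1, h2⟩, hx⟩
    have hb := h13.bounds (t := (t : ℝ) / 2) (x := x)
      (fun v a b c habc => by have := h1 v a b c habc; constructor <;> linarith) h2
    obtain ⟨w, rfl⟩ := exists_natCast_eq hx fun e => (hb e).1
    beta_reduce at h1 hb
    refine ⟨w, ⟨fun e => ?_, fun v a b c habc => ?_⟩, rfl⟩
    · have h3 := (hb e).2
      rw [le_div_iff₀ two_pos] at h3
      rw [Nat.le_div_iff_mul_le two_pos]
      exact_mod_cast h3
    · obtain ⟨h3, h4⟩ := h1 v _ _ _ habc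
      have h5 := (h1 v _ _ _ habc.swap_left).1
      have h6 := (h1 v _ _ _ habc.swap_right.swap_left).1
      exact ⟨by exact_mod_cast h3, by exact_mod_cast h5, by exact_mod_cast h6, by exact_mod_cast h4⟩
  · rintro ⟨w, ⟨h1, h2⟩, rfl⟩
    refine ⟨⟨fun v a b c habc => ?_, fun e _ => ⟨Nat.cast_nonneg _, ?_⟩⟩, fun e => ⟨w e, by simp⟩⟩
    all_goals beta_reduce
    · obtain ⟨h3, -, -, h4⟩ := h2 v a b c habc
      exact ⟨by exact_mod_cast h3, by exact_mod_cast h4⟩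
    · have h3 := h1 e
      rw [Nat.le_div_iff_mul_le two_pos] at h3
      rw [le_div_iff₀ two_pos]
      exact_mod_cast h3

/-- The coordinate z is determined by the edge labels as half the perimeter at each node, so its
integrality is the evenness of that perimeter. -/
theorem IsOneThreeGraph.ehrhartQ_eq (h13 : G.IsOneThreeGraph) (t : ℕ) :
    G.ehrhartQ t = {w | G.IsEdgeLabeling t (EvenTriangleRule t) w}.ncard := by
  let F : (G.edgeSet → ℕ) → (G.edgeSet → ℝ) × (G.InternalNode → ℝ) := fun w =>
    (fun e => (w e : ℝ), fun v => (∑ e ∈ G.edgesAtFinset v, (w e : ℝ)) / 2)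
  have hF : Function.Injective F := fun w w' h =>
    natCast_comp_injective G.edgeSet (congrArg Prod.fst h)
  rw [← Set.ncard_image_of_injective _ hF, ehrhartQ, ehrhartFunction]
  congr 1
  ext ⟨x, z⟩
  rw [Set.mem_inter_iff, h13.mem_smul_polytopeQ, Set.mem_prod]
  constructor
  · rintro ⟨⟨h1, h2⟩, hx, hz⟩
    have hb := h13.bounds (t := (t : ℝ)) (x := x)
      (fun v a b c habc => by have := h1 v a b c habc; constructor <;> linarith) h2
    obtain ⟨w, rfl⟩ := exists_natCast_eq hx fun e => (hb e).1
    beta_reduce at h1 hb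
    refine ⟨w, ⟨fun e => by exact_mod_cast (hb e).2, fun v a b c habc => ?_⟩, ?_⟩
    · obtain ⟨h3, h4, h7⟩ := h1 v _ _ _ habc
      have h5 := (h1 v _ _ _ habc.swap_left).1
      have h6 := (h1 v _ _ _ habc.swap_right.swap_left).1
      obtain ⟨n, hn⟩ := hz v
      simp only at hn
      have h8 : (w a : ℝ) + w b + w c ≤ 2 * t := by linarith
      have h9 : ((w a + w b + w c : ℕ) : ℤ) = 2 * n := by
        rw [hn] at h4
        exact_mod_cast h4
      refine ⟨by exact_mod_cast h3, by exact_mod_cast h5, by exact_mod_cast h6,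
        by exact_mod_cast h8, ?_⟩
      rw [Nat.even_iff]
      omega
    · refine Prod.ext rfl (funext fun v => ?_)
      obtain ⟨a, b, c, habc⟩ := exists_edgesAt v.2
      have h4 := (h1 v a b c habc).2.1
      simp only [F]
      rw [habc.sum_eq v.2 (fun e => (w e : ℝ)), h4]
      ring
  · rintro ⟨w, ⟨h1, h2⟩, hw⟩
    obtain ⟨rfl, rfl⟩ := Prod.ext_iff.mp hw
    simp only [F]
    refine ⟨⟨fun v a b c habc => ?_, fun e _ => ⟨Nat.cast_nonneg _, by exact_mod_cast h1 e⟩⟩,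
      fun e => ⟨w e, by simp⟩, fun v => ?_⟩
    · obtain ⟨h3, -, -, h4, -⟩ := h2 v a b c habc
      have h4' : (w a : ℝ) + w b + w c ≤ 2 * t := by exact_mod_cast h4
      rw [habc.sum_eq v.2 (fun e => (w e : ℝ))]
      exact ⟨by exact_mod_cast h3, by ring, by linarith⟩
    · obtain ⟨a, b, c, habc⟩ := exists_edgesAt v.2
      obtain ⟨-, -, -, -, n, hn⟩ := h2 v a b c habc
      refine ⟨n, ?_⟩
      simp only
      rw [habc.sum_eq v.2 (fun e => (w e : ℝ))]
      have : (w a : ℝ) + w b + w c = n + n := by exact_mod_cast hn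
      rw [this]
      push_cast
      ring

end SimpleGraph

/-! ### Quasi-polynomials -/

theorem polynomial_eq_of_frequently_eval_eq {p q : Polynomial ℝ}
    (h : ∃ᶠ t : ℕ in Filter.atTop, p.eval (t : ℝ) = q.eval (t : ℝ)) : p = q := by
  refine Polynomial.eq_of_infinite_eval_eq p q
    (((Nat.frequently_atTop_iff_infinite.mp h).image Nat.cast_injective.injOn).mono ?_)
  rintro _ ⟨t, ht, rfl⟩
  exact ht

theorem isQuasiPolynomialOfPeriod_one {f : ℕ → ℕ} {p : Polynomial ℝ}
    (h : ∀ t, (f t : ℝ) = p.eval (t : ℝ)) : IsQuasiPolynomialOfPeriod f 1 :=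
  ⟨⟨one_pos, fun _ => p, fun _ t _ => h t⟩, fun _ hβ => hβ.1⟩

/-- A single polynomial for f would agree with p at all even and with q at all odd arguments,
infinitely many each, forcing p = q. -/
theorem isQuasiPolynomialOfPeriod_two {f : ℕ → ℕ} {p q : Polynomial ℝ}
    (hp : ∀ t, Even t → (f t : ℝ) = p.eval (t : ℝ))
    (hq : ∀ t, Odd t → (f t : ℝ) = q.eval (t : ℝ)) (hpq : p ≠ q) :
    IsQuasiPolynomialOfPeriod f 2 := by
  refine ⟨⟨two_pos, ![p, q], fun i t ht => ?_⟩, ?_⟩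
  · fin_cases i
    · exact hp t (Nat.even_iff.mpr ht)
    · exact hq t (Nat.odd_iff.mpr ht)
  · rintro β ⟨hβ, u, hu⟩
    by_contra! hlt
    obtain rfl : β = 1 := by omega
    have hu' : ∀ t, (f t : ℝ) = (u 0).eval (t : ℝ) := fun t => hu 0 t (Nat.modEq_one)
    refine hpq (.trans (polynomial_eq_of_frequently_eval_eq ?_)
      (polynomial_eq_of_frequently_eval_eq ?_) (b := u 0))
    · exact Nat.frequently_even.mono fun t ht => by rw [← hp t ht, hu']
    · exact Nat.frequently_odd.mono fun t ht => by rw [← hq t ht, hu']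

theorem mainTheorem2 {V : Type*} [Fintype V] (T : SimpleGraph V) [DecidableRel T.Adj]
    (hT : T.IsTree) (hT13 : T.IsOneThreeGraph) :
    IsQuasiPolynomialOfPeriod T.ehrhartP 2 ∧ IsQuasiPolynomialOfPeriod T.ehrhartQ 1 := by
  obtain ⟨k, hk⟩ := hT.exists_ncard_edgeLabelings hT13
  obtain ⟨p, hp, hp1⟩ := exists_polynomial_fusionPow_triangleRule_even k
  obtain ⟨q, hq, hq1⟩ := exists_polynomial_fusionPow_triangleRule_odd k
  obtain ⟨u, hu⟩ := exists_polynomial_fusionPow_evenTriangleRule k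
  have hP : ∀ t, T.ehrhartP t = fusionPow (t / 2) (TriangleRule t) (k + 1) 0 := fun t => by
    rw [hT13.ehrhartP_eq, hk _ _ (triangleRule_fusionRule t)]
  have hQ : ∀ t, T.ehrhartQ t = fusionPow t (EvenTriangleRule t) (k + 1) 0 := fun t => by
    rw [hT13.ehrhartQ_eq, hk _ _ (evenTriangleRule_fusionRule t)]
  refine ⟨isQuasiPolynomialOfPeriod_two (p := p) (q := q) (fun t ht => by rw [hP, hp t ht])
    (fun t ht => by rw [hP, hq t ht]) ?_, isQuasiPolynomialOfPeriod_one fun t => by rw [hQ, hu t]⟩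
  -- Equal constituents would have the same value at t = -1, yet one is positive there and the other
  -- zero.
  rintro rfl
  exact hp1.ne' hq1
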